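/- Let $n\ge 1$ and let $p_i:(0,1]\to[0,\infty)$, $i=1,\dots,n$, be $C^1$, strictly decreasing, convex, integrable functions with $\lim_{x\to0^+}p_i(x)=+\infty$ (for example $p_i(x)=s_ix^{-\gamma}$ with $s_i>0$, $\gamma\in(0,1)$). Write $\mathrm{int}(\Delta_n)=\{x\in\mathbb R^n: x>0,\ \mathbf 1^\top x=1\}$ and $p(w)=(p_1(w_1),\dots,p_n(w_n))^\top$, and assume that $p(w)>0$ for $w\in\mathrm{int}(\Delta_n)$ (automatic if $n\ge2$). There is a unique pair $(p^*,w^{\mathrm{opt}})$ with $p^*>0$, $w^{\mathrm{opt}}\in\mathrm{int}(\Delta_n)$ and $p(w^{\mathrm{opt}})=p^*\mathbf 1$. The ASAP model with donor-controlled work flow is the system $$\dot a_{ij}=a_{ij}\Big(p_j(w_j)-\sum_{k=1}^n a_{ik}p_k(w_k)\Big),\qquad \dot w_i=-w_i+\sum_{k=1}^n a_{ki}w_k ,$$ whose solutions are understood to satisfy $w_i(t)\in(0,1]$, the domain of $p_i$. For an irreducible row-stochastic matrix $B$ let $v_{\mathrm{left}}(B)$ denote its left dominant eigenvector: the entrywise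 positive left eigenvector of unit sum for the dominant eigenvalue of $B$. Let $A_0\in\mathbb R^{n\times n}$ be row-stochastic and irreducible with strictly positive diagonal, and let $w_0\in\mathrm{int}(\Delta_n)$. Then the model has a solution on $[0,\infty)$ with $(A(0),w(0))=(A_0,w_0)$, and every such solution $(A(t),w(t))$ has the following properties. (i) If $n=2$ and $A_0>0$ entrywise, then $\lim_{t\to\infty}(A(t),w(t))=(A^*,w^{\mathrm{opt}})$ for some row-stochastic $A^*>0$ with $w^{\mathrm{opt}}=v_{\mathrm{left}}(A^*)$. (ii) If $A_0=\mathbf 1a^\top$ for some $a\in\mathrm{int}(\Delta_n)$ (so that $a$ is the diagonal of $A_0$), then $\lim_{t\to\infty}(A(t),w(t))=(\mathbf 1(w^{\mathrm{opt}})^\top,w^{\mathrm{opt}})$. (iii) For $v\in\mathbb R^n_{>0}$ put $\mathcal A(v)=\mathrm{diag}(A_0v)^{-1}A_0\,\mathrm{diag}(v)$. The reduced-order system $$\dot v=\mathrm{diag}\big(p(\bar w)-\bar w^\top\mathcal A(v)p(\bar w)\mathbf 1\big)v,\qquad \dot{\bar w}=-\bar w+\mathcal A(v)^\top\bar w,$$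 has a solution on $[0,\infty)$ with values in $\mathbb R^n_{>0}\times\mathrm{int}(\Delta_n)$ and $(v(0),\bar w(0))=(\mathbf 1,w_0)$. If for such a solution $v(t)$ is bounded on $[0,\infty)$, then $\lim_{t\to\infty}(A(t),w(t))=(A^*,w^{\mathrm{opt}})$ for some row-stochastic $A^*$ that has the same zero/positive pattern as $A_0$ and satisfies $w^{\mathrm{opt}}=v_{\mathrm{left}}(A^*)$. -/

import Mathlib

open Filter Topology

/-- The relative interior of the simplex: entrywise positive vectors with unit sum. -/
def intSimplex (n : ℕ) : Set (Fin n → ℝ) :=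
  {x | (∀ i, 0 < x i) ∧ ∑ i, x i = 1}

/-- An individual performance function `(0,1] → [0,∞)`: `C¹`, strictly decreasing, convex,
integrable, and tending to `+∞` at `0⁺`. Values outside `(0,1]` are irrelevant. -/
structure IsPerformanceFunction (f : ℝ → ℝ) : Prop where
  nonneg : ∀ x ∈ Set.Ioc (0 : ℝ) 1, 0 ≤ f x
  contDiffOn : ContDiffOn ℝ 1 f (Set.Ioc 0 1)
  strictAntiOn : StrictAntiOn f (Set.Ioc 0 1)
  convexOn : ConvexOn ℝ (Set.Ioc 0 1) f
  integrableOn : MeasureTheory.IntegrableOn f (Set.Ioc 0 1)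
  tendsto_zero : Tendsto f (𝓝[>] 0) atTop

/-- A family of performance functions for a team of `n` individuals; the vector of performances
`p(w)` is entrywise positive for workloads `w` in the relative interior of the simplex. -/
structure IsPerformanceFamily {n : ℕ} (p : Fin n → ℝ → ℝ) : Prop where
  each : ∀ i, IsPerformanceFunction (p i)
  pos : ∀ w ∈ intSimplex n, ∀ i, 0 < p i (w i)

/-- The vector of individual performances `p(w) = (p₁(w₁), …, pₙ(wₙ))`. -/
def perf {n : ℕ} (p : Fin n → ℝ → ℝ) (w : Fin n → ℝ) : Fin n → ℝ :=
  fun i => p i (w i)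

/-- The pair `(p*, w)` has `p* > 0`, `w` in the relative interior of the simplex, and
`p(w) = p* 𝟏`. -/
def IsOptimalPair {n : ℕ} (p : Fin n → ℝ → ℝ) (q : ℝ × (Fin n → ℝ)) : Prop :=
  0 < q.1 ∧ q.2 ∈ intSimplex n ∧ perf p q.2 = fun _ => q.1

/-- Right-hand side of the appraisal dynamics. -/
def appraisalField {n : ℕ} (p : Fin n → ℝ → ℝ) (A : Matrix (Fin n) (Fin n) ℝ)
    (w : Fin n → ℝ) : Matrix (Fin n) (Fin n) ℝ :=
  fun i j => A i j * (p j (w j) - ∑ k, A i k * p k (w k))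

/-- The donor-controlled work flow. -/
def donorFlow {n : ℕ} (A : Matrix (Fin n) (Fin n) ℝ) (w : Fin n → ℝ) : Fin n → ℝ :=
  fun i => -w i + ∑ k, A k i * w k

/-- `(A, w)` is a solution on `[0, ∞)` of the assignment and appraisal dynamics with
donor-controlled work flow and initial condition `(A₀, w₀)`. The condition `mem_domain` says that
the solution stays where the vector field is defined, each `p i` being a function on `(0,1]`. -/
structure IsASAPTrajectory {n : ℕ} (p : Fin n → ℝ → ℝ)
    (A₀ : Matrix (Fin n) (Fin n) ℝ) (w₀ : Fin n → ℝ)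
    (A : ℝ → Matrix (Fin n) (Fin n) ℝ) (w : ℝ → Fin n → ℝ) : Prop where
  init_A : A 0 = A₀
  init_w : w 0 = w₀
  mem_domain : ∀ t, 0 ≤ t → ∀ i, w t i ∈ Set.Ioc (0 : ℝ) 1
  deriv_A : ∀ t, 0 ≤ t → ∀ i j,
    HasDerivWithinAt (fun s => A s i j) (appraisalField p (A t) (w t) i j) (Set.Ici 0) t
  deriv_w : ∀ t, 0 ≤ t → ∀ i,
    HasDerivWithinAt (fun s => w s i) (donorFlow (A t) (w t) i) (Set.Ici 0) t

/-- The map `𝒜(v) = diag(A₀ v)⁻¹ A₀ diag(v)`. -/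
noncomputable def reducedAppraisal {n : ℕ} (A₀ : Matrix (Fin n) (Fin n) ℝ) (v : Fin n → ℝ) :
    Matrix (Fin n) (Fin n) ℝ :=
  Matrix.diagonal (fun i => ((A₀.mulVec v) i)⁻¹) * A₀ * Matrix.diagonal v

/-- `(v, w)` is a solution on `[0, ∞)`, with values in the positive vectors times the relative
interior of the simplex, of the reduced-order dynamics
`v' = diag(p(w) - wᵀ 𝒜(v) p(w) 𝟏) v`, `w' = -w + 𝒜(v)ᵀ w`,
with initial condition `(𝟏, w₀)`. -/
structure IsReducedTrajectory {n : ℕ} (p : Fin n → ℝ → ℝ)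
    (A₀ : Matrix (Fin n) (Fin n) ℝ) (w₀ : Fin n → ℝ)
    (v : ℝ → Fin n → ℝ) (w : ℝ → Fin n → ℝ) : Prop where
  init_v : v 0 = fun _ => 1
  init_w : w 0 = w₀
  pos_v : ∀ t, 0 ≤ t → ∀ i, 0 < v t i
  mem_w : ∀ t, 0 ≤ t → w t ∈ intSimplex n
  deriv_v : ∀ t, 0 ≤ t → ∀ i,
    HasDerivWithinAt (fun s => v s i)
      ((perf p (w t) i - w t ⬝ᵥ (reducedAppraisal A₀ (v t)).mulVec (perf p (w t))) * v t i)
      (Set.Ici 0) t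
  deriv_w : ∀ t, 0 ≤ t → ∀ i,
    HasDerivWithinAt (fun s => w s i) (donorFlow (reducedAppraisal A₀ (v t)) (w t) i)
      (Set.Ici 0) t

/-- `ρ` is the dominant eigenvalue of `B`: an eigenvalue whose modulus is maximal among all
complex eigenvalues of `B`. -/
def IsDominantEigenvalue {n : ℕ} (B : Matrix (Fin n) (Fin n) ℝ) (ρ : ℝ) : Prop :=
  (ρ : ℂ) ∈ spectrum ℂ (B.map Complex.ofReal) ∧
    ∀ μ ∈ spectrum ℂ (B.map Complex.ofReal), ‖μ‖ ≤ ρ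

/-- `B` is irreducible and row-stochastic, and `x` is its left dominant eigenvector: positive, of
unit sum, and a left eigenvector for the dominant eigenvalue. -/
def IsLeftDominantEigenvector {n : ℕ} (B : Matrix (Fin n) (Fin n) ℝ) (x : Fin n → ℝ) : Prop :=
  B.IsIrreducible ∧ B ∈ Matrix.rowStochastic ℝ (Fin n) ∧ x ∈ intSimplex n ∧
    ∃ ρ : ℝ, IsDominantEigenvalue B ρ ∧ Matrix.vecMul x B = ρ • x

/-- Two nonnegative matrices have the same zero/positive pattern. -/
def SamePattern {n : ℕ} (A B : Matrix (Fin n) (Fin n) ℝ) : Prop :=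
  ∀ i j, (A i j = 0 ↔ B i j = 0) ∧ (0 < A i j ↔ 0 < B i j)

/-!
Let `y` be the vector of cumulative performances, `y' = p(w)` and `y(0) = 0`. Each row of `A`
solves a replicator equation, so `A = 𝒜(eʸ)`: the row-stochastic matrix `A₀ diag(eʸ)` rescaled by
rows. Since `𝒜` is homogeneous, the reduced-order dynamics is the same flow with `v = exp(y - Θ)`,
where `Θ' = wᵀ A p(w)`, and global existence and uniqueness come from the Lipschitz equations for
`(y, w)`.

Put `z' = wᵀ p(w)`. As `p` is decreasing, `U = w_optᵀ y - z` has derivative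
`(w_opt - w)ᵀ (p(w) - p(w_opt)) ≥ 0`, which is bounded away from zero while `w` is away from
`w_opt`. Moreover `(Θ - z)' = p(w)ᵀ w'`, so `Θ - z` is bounded because the integrable functions
`pᵢ` have bounded antiderivatives. Suppose now that `y - z` is bounded above. Then `U` converges,
whence `w → w_opt` and, by Barbalat's lemma, `w' → 0`; moreover `y - z` stays in a compact set.
Thus `A` accumulates only at matrices `𝒜(eˣ)` for which `w_opt` is stationary. These are given by
the critical points of the convex function `F_x = ∑ᵢ w_optᵢ log (A₀ eˣ)ᵢ - w_optᵀ x`, and strict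
convexity of the exponential along the edges of `A₀` leaves only one such matrix.

It remains to bound `y - z`, equivalently `y - Θ`, from above. In (iii) this is the boundedness of
`v`. In (ii) all rows of `A` agree and `Θ = log ∑ⱼ aⱼ exp(yⱼ)` dominates each `yⱼ + log aⱼ`. In (i)
the derivative of `F_y - (Θ - z)` is `-(A₁₂ + A₂₁) U'`, so `F_y` is bounded above; as `A₀ > 0`,
this bounds the deviations `yⱼ - w_optᵀ y` and keeps `A₁₂` away from zero, so that `U` is bounded
as well.
-/

/-! ### Calculus and differential equations on intervals -/

section Calculus

theorem monotoneOn_of_forall_hasDerivWithinAt_nonneg {D : Set ℝ} (hD : Convex ℝ D)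
    {f f' : ℝ → ℝ} (hf : ∀ x ∈ D, HasDerivWithinAt f (f' x) D x) (hf' : ∀ x ∈ D, 0 ≤ f' x) :
    MonotoneOn f D :=
  monotoneOn_of_hasDerivWithinAt_nonneg hD (fun x hx => (hf x hx).continuousWithinAt)
    (fun x hx => (hf x (interior_subset hx)).mono interior_subset)
    fun x hx => hf' x (interior_subset hx)

theorem eqOn_const_of_forall_hasDerivWithinAt_zero {E : Type*} [NormedAddCommGroup E]
    [NormedSpace ℝ E] {D : Set ℝ} (hD : Convex ℝ D) {f : ℝ → E}
    (hf : ∀ x ∈ D, HasDerivWithinAt f 0 D x) {x y : ℝ} (hx : x ∈ D) (hy : y ∈ D) : f x = f y := by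
  have h := hD.norm_image_sub_le_of_norm_hasDerivWithin_le (C := 0) hf (fun _ _ => by simp) hy hx
  rw [zero_mul, norm_le_zero_iff, sub_eq_zero] at h
  exact h

theorem eq_mul_exp_of_forall_hasDerivWithinAt {D : Set ℝ} (hD : Convex ℝ D) {x r R : ℝ → ℝ}
    (hx : ∀ t ∈ D, HasDerivWithinAt x (x t * r t) D t)
    (hR : ∀ t ∈ D, HasDerivWithinAt R (r t) D t) {s t : ℝ} (hs : s ∈ D) (ht : t ∈ D) :
    x t = x s * Real.exp (R t - R s) := by
  have hconst : ∀ u ∈ D, HasDerivWithinAt (fun u => x u * Real.exp (-R u)) 0 D u := fun u hu =>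
    ((hx u hu).fun_mul (hR u hu).fun_neg.exp).congr_deriv (by ring)
  have h := eqOn_const_of_forall_hasDerivWithinAt_zero hD hconst ht hs
  rw [sub_eq_add_neg, add_comm, Real.exp_add, ← mul_assoc, ← h, mul_assoc, ← Real.exp_add,
    neg_add_cancel, Real.exp_zero, mul_one]

theorem hasDerivWithinAt_integral_Ici {E : Type*} [NormedAddCommGroup E] [NormedSpace ℝ E]
    [CompleteSpace E] {h : ℝ → E} {a : ℝ} (hc : ContinuousOn h (Set.Ici a)) {t : ℝ} (ht : a ≤ t) :
    HasDerivWithinAt (fun t => ∫ s in a..t, h s) (h t) (Set.Ici a) t := by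
  have hcont : Continuous fun s => h (max s a) :=
    hc.comp_continuous (by fun_prop) fun s => Set.mem_Ici.2 (le_max_right _ _)
  have hderiv := (hcont.integral_hasStrictDerivAt a t).hasDerivAt.hasDerivWithinAt
    (s := Set.Ici a)
  rw [max_eq_left ht] at hderiv
  have hcongr : ∀ u ∈ Set.Ici a, ∫ s in a..u, h s = ∫ s in a..u, h (max s a) := fun u hu =>
    intervalIntegral.integral_congr fun s hs => by
      rw [Set.uIcc_of_le hu] at hs
      simp only [max_eq_left hs.1]
  exact hderiv.congr hcongr (hcongr t ht)

theorem exists_tendsto_atTop_of_monotoneOn_Ici {f : ℝ → ℝ} {a C : ℝ}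
    (hmono : MonotoneOn f (Set.Ici a)) (hC : ∀ t, a ≤ t → f t ≤ C) :
    ∃ l, Tendsto f atTop (𝓝 l) := by
  have hmono' : Monotone fun t => f (max t a) := fun s t hst =>
    hmono (Set.mem_Ici.2 (le_max_right _ _)) (Set.mem_Ici.2 (le_max_right _ _))
      (max_le_max_right _ hst)
  have hbdd : BddAbove (Set.range fun t => f (max t a)) :=
    ⟨C, Set.forall_mem_range.2 fun t => hC _ (le_max_right _ _)⟩
  refine ⟨_, (tendsto_atTop_ciSup hmono' hbdd).congr' ?_⟩
  filter_upwards [eventually_ge_atTop a] with t ht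
  rw [max_eq_left ht]

theorem eventually_lt_of_uniformContinuousOn {U U' f : ℝ → ℝ} {a l : ℝ}
    (hU : ∀ t ∈ Set.Ici a, HasDerivWithinAt U (U' t) (Set.Ici a) t)
    (hl : Tendsto U atTop (𝓝 l)) (hf : UniformContinuousOn f (Set.Ici a))
    (hgap : ∀ δ > 0, ∃ m > 0, ∀ t ∈ Set.Ici a, δ ≤ f t → m ≤ U' t) {δ : ℝ} (hδ : 0 < δ) :
    ∀ᶠ t in atTop, f t < δ := by
  obtain ⟨m, hm0, hm⟩ := hgap (δ / 2) (half_pos hδ)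
  obtain ⟨h, hh0, hh⟩ := Metric.uniformContinuousOn_iff.1 hf (δ / 2) (half_pos hδ)
  have hstep : Tendsto (fun t => U (t + h / 2) - U t) atTop (𝓝 0) := by
    simpa using (hl.comp (tendsto_atTop_add_const_right _ (h / 2) tendsto_id)).sub hl
  filter_upwards [hstep.eventually (gt_mem_nhds (mul_pos hm0 (half_pos hh0))),
    eventually_ge_atTop a] with t hsmall hta
  by_contra! hlarge
  have hsub : Set.Icc t (t + h / 2) ⊆ Set.Ici a := fun s hs => hta.trans hs.1
  have hlow : ∀ s ∈ Set.Icc t (t + h / 2), m ≤ U' s := fun s hs => by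
    have hclose := hh s (hsub hs) t hta (by
      rw [Real.dist_eq, abs_of_nonneg (by linarith [hs.1])]
      linarith [hs.2])
    exact hm s (hsub hs) (by linarith [(abs_lt.1 hclose).1])
  have hmono : MonotoneOn (fun s => U s - s * m) (Set.Icc t (t + h / 2)) :=
    monotoneOn_of_forall_hasDerivWithinAt_nonneg (convex_Icc _ _)
      (fun s hs => ((hU s (hsub hs)).mono hsub).fun_sub
        ((hasDerivWithinAt_id s _).mul_const m))
      (fun s hs => by linarith [hlow s hs])
  have hincr := hmono (Set.left_mem_Icc.2 (by linarith)) (Set.right_mem_Icc.2 (by linarith))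
    (by linarith)
  simp only at hincr
  linarith

/-- Barbalat's lemma. -/
theorem tendsto_zero_of_uniformContinuousOn_deriv {U U' : ℝ → ℝ} {a l : ℝ}
    (hU : ∀ t ∈ Set.Ici a, HasDerivWithinAt U (U' t) (Set.Ici a) t)
    (hl : Tendsto U atTop (𝓝 l)) (hU' : UniformContinuousOn U' (Set.Ici a)) :
    Tendsto U' atTop (𝓝 0) := by
  refine Metric.tendsto_nhds.2 fun δ hδ => ?_
  have hpos := eventually_lt_of_uniformContinuousOn hU hl hU'
    (fun δ hδ => ⟨δ, hδ, fun t _ h => h⟩) hδ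
  have hneg := eventually_lt_of_uniformContinuousOn (fun t ht => (hU t ht).fun_neg) hl.neg
    (uniformContinuous_neg.comp_uniformContinuousOn hU')
    (fun δ hδ => ⟨δ, hδ, fun t _ h => h⟩) hδ
  filter_upwards [hpos, hneg] with t h1 h2
  rw [dist_zero_right]
  exact abs_lt.2 ⟨by simpa using neg_lt_neg h2, h1⟩

theorem mul_exp_neg_two_mul_le {f f' : ℝ → ℝ} {ε : ℝ} (hε : 0 < ε) (h0 : ε ≤ f 0)
    (hf : ∀ t ∈ Set.Ici 0, HasDerivWithinAt f (f' t) (Set.Ici 0) t)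
    (hf' : ∀ t ∈ Set.Ici 0, f t = ε * Real.exp (-2 * t) → -f t ≤ f' t) {t : ℝ} (ht : 0 ≤ t) :
    ε * Real.exp (-2 * t) ≤ f t := by
  have hbarrier : ∀ x, HasDerivAt (fun x => -(ε * Real.exp (-2 * x)))
      (2 * (ε * Real.exp (-2 * x))) x := fun x =>
    (((hasDerivAt_id x).const_mul (-2)).exp.const_mul ε).fun_neg.congr_deriv (by simp; ring)
  have hle := image_le_of_deriv_right_lt_deriv_boundary (f := fun x => -f x)
    (f' := fun x => -f' x) (a := 0) (b := t)
    (fun x hx => ((hf x hx.1).continuousWithinAt.mono fun r hr => hr.1).neg)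
    (fun x hx => ((hf x hx.1).mono fun r hr => hx.1.trans hr).fun_neg)
    (by simpa using h0) hbarrier (fun x hx hfx => by
      have := hf' x hx.1 (by linarith)
      have := mul_pos hε (Real.exp_pos (-2 * x))
      linarith) ⟨ht, le_rfl⟩
  simpa using hle

end Calculus

section GlobalODE

variable {E : Type*} [NormedAddCommGroup E] [NormedSpace ℝ E] {f : ℝ → E → E} {a : ℝ}

theorem eqOn_Icc_of_hasDerivWithinAt {b : ℝ} {K : NNReal}
    (hK : ∀ t ∈ Set.Icc a b, LipschitzWith K (f t)) {x y : ℝ → E}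
    (hx : ∀ t ∈ Set.Icc a b, HasDerivWithinAt x (f t (x t)) (Set.Icc a b) t)
    (hy : ∀ t ∈ Set.Icc a b, HasDerivWithinAt y (f t (y t)) (Set.Icc a b) t)
    (hxy : x a = y a) : Set.EqOn x y (Set.Icc a b) := by
  have hright : ∀ z : ℝ → E,
      (∀ t ∈ Set.Icc a b, HasDerivWithinAt z (f t (z t)) (Set.Icc a b) t) →
      ∀ t ∈ Set.Ico a b, HasDerivWithinAt z (f t (z t)) (Set.Ici t) t := fun z hz t ht =>
    (hz t ⟨ht.1, ht.2.le⟩).mono_of_mem_nhdsWithin <| by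
      filter_upwards [Icc_mem_nhdsGE ht.2] with s hs using ⟨ht.1.trans hs.1, hs.2⟩
  exact ODE_solution_unique_of_mem_Icc_right (s := fun _ => Set.univ)
    (fun t ht => (hK t ⟨ht.1, ht.2.le⟩).lipschitzOnWith)
    (fun t ht => (hx t ht).continuousWithinAt) (hright x hx) (fun _ _ => trivial)
    (fun t ht => (hy t ht).continuousWithinAt) (hright y hy) (fun _ _ => trivial) hxy

theorem eqOn_Ici_of_hasDerivWithinAt
    (hK : ∀ b, a ≤ b → ∃ K : NNReal, ∀ t ∈ Set.Icc a b, LipschitzWith K (f t)) {x y : ℝ → E}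
    (hx : ∀ t ∈ Set.Ici a, HasDerivWithinAt x (f t (x t)) (Set.Ici a) t)
    (hy : ∀ t ∈ Set.Ici a, HasDerivWithinAt y (f t (y t)) (Set.Ici a) t)
    (hxy : x a = y a) : Set.EqOn x y (Set.Ici a) := fun t ht => by
  obtain ⟨K, hK⟩ := hK t ht
  exact eqOn_Icc_of_hasDerivWithinAt hK (fun s hs => (hx s hs.1).mono Set.Icc_subset_Ici_self)
    (fun s hs => (hy s hs.1).mono Set.Icc_subset_Ici_self) hxy ⟨ht, le_rfl⟩

theorem exists_hasDerivWithinAt_Icc [CompleteSpace E] {b : ℝ} (hab : a ≤ b) {K L : NNReal}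
    (hK : ∀ t ∈ Set.Icc a b, LipschitzWith K (f t))
    (hL : ∀ t ∈ Set.Icc a b, ∀ x, ‖f t x‖ ≤ L)
    (hc : ∀ x, ContinuousOn (fun t => f t x) (Set.Icc a b)) (x₀ : E) :
    ∃ x : ℝ → E, x a = x₀ ∧
      ∀ t ∈ Set.Icc a b, HasDerivWithinAt x (f t (x t)) (Set.Icc a b) t := by
  have h : IsPicardLindelof f (⟨a, Set.left_mem_Icc.2 hab⟩ : Set.Icc a b) x₀
      (L * (b - a).toNNReal) 0 L K :=
    { lipschitzOnWith := fun t ht => (hK t ht).lipschitzOnWith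
      continuousOn := fun x _ => hc x
      norm_le := fun t ht x _ => hL t ht x
      mul_max_le := by simp [hab] }
  exact h.exists_eq_forall_mem_Icc_hasDerivWithinAt₀

theorem exists_hasDerivWithinAt_Ici [CompleteSpace E]
    (hK : ∀ b, a ≤ b → ∃ K : NNReal, ∀ t ∈ Set.Icc a b, LipschitzWith K (f t))
    (hL : ∀ b, a ≤ b → ∃ L : NNReal, ∀ t ∈ Set.Icc a b, ∀ x, ‖f t x‖ ≤ L)
    (hc : ∀ x, ContinuousOn (fun t => f t x) (Set.Ici a)) (x₀ : E) :
    ∃ x : ℝ → E, x a = x₀ ∧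
      ∀ t ∈ Set.Ici a, HasDerivWithinAt x (f t (x t)) (Set.Ici a) t := by
  have hlocal : ∀ b, a ≤ b → ∃ x : ℝ → E, x a = x₀ ∧
      ∀ t ∈ Set.Icc a b, HasDerivWithinAt x (f t (x t)) (Set.Icc a b) t := fun b hb => by
    obtain ⟨K, hK⟩ := hK b hb
    obtain ⟨L, hL⟩ := hL b hb
    exact exists_hasDerivWithinAt_Icc hb hK hL
      (fun x => (hc x).mono Set.Icc_subset_Ici_self) x₀
  choose! X hX₀ hX using hlocal
  have hagree : ∀ b c, a ≤ b → b ≤ c → Set.EqOn (X b) (X c) (Set.Icc a b) :=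
    fun b c hb hbc => by
      obtain ⟨K, hK⟩ := hK b hb
      have hsub : Set.Icc a b ⊆ Set.Icc a c := Set.Icc_subset_Icc_right hbc
      exact eqOn_Icc_of_hasDerivWithinAt hK (hX b hb)
        (fun t ht => (hX c (hb.trans hbc) t (hsub ht)).mono hsub)
        (by rw [hX₀ b hb, hX₀ c (hb.trans hbc)])
  refine ⟨fun t => X t t, hX₀ a le_rfl, fun t ht => ?_⟩
  have hat : a ≤ t := ht
  have hnhds : Set.Icc a (t + 1) ∈ 𝓝[Set.Ici a] t := by
    filter_upwards [self_mem_nhdsWithin, mem_nhdsWithin_of_mem_nhds (Iio_mem_nhds (lt_add_one t))]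
      with s hs hst using ⟨hs, hst.le⟩
  have heq : ∀ s ∈ Set.Icc a (t + 1), X s s = X (t + 1) s := fun s hs =>
    hagree s (t + 1) hs.1 hs.2 ⟨hs.1, le_rfl⟩
  have hmem : t ∈ Set.Icc a (t + 1) := ⟨hat, by linarith⟩
  simp only [heq t hmem]
  exact ((hX (t + 1) (by linarith) t hmem).mono_of_mem_nhdsWithin hnhds).congr_of_eventuallyEq
    (by filter_upwards [hnhds] with s hs using heq s hs) (heq t hmem)

end GlobalODE

open scoped Matrix

/-! ### Row-stochastic matrices and their exponential tilts -/

section Appraisal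

variable {n : ℕ} {A : Matrix (Fin n) (Fin n) ℝ}

theorem mulVec_pos_of_mem_rowStochastic (hA : A ∈ Matrix.rowStochastic ℝ (Fin n))
    {v : Fin n → ℝ} (hv : ∀ i, 0 < v i) (i : Fin n) : 0 < (A *ᵥ v) i := by
  obtain ⟨k, -, hk⟩ : ∃ k ∈ Finset.univ, 0 < A i k :=
    Finset.exists_lt_of_sum_lt (by simp [Matrix.sum_row_of_mem_rowStochastic hA i])
  exact Finset.sum_pos' (fun j _ => mul_nonneg (hA.1 i j) (hv j).le)
    ⟨k, Finset.mem_univ k, mul_pos hk (hv k)⟩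

theorem norm_mulVec_le_of_mem_rowStochastic (hA : A ∈ Matrix.rowStochastic ℝ (Fin n))
    (q : Fin n → ℝ) : ‖A *ᵥ q‖ ≤ ‖q‖ := by
  refine (pi_norm_le_iff_of_nonneg (norm_nonneg q)).2 fun i => ?_
  calc ‖∑ k, A i k * q k‖ ≤ ∑ k, A i k * ‖q‖ := norm_sum_le_of_le _ fun k _ => by
        rw [norm_mul, Real.norm_of_nonneg (hA.1 i k)]
        exact mul_le_mul_of_nonneg_left (norm_le_pi_norm q k) (hA.1 i k)
    _ = ‖q‖ := by rw [← Finset.sum_mul, Matrix.sum_row_of_mem_rowStochastic hA, one_mul]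

theorem reducedAppraisal_apply (A : Matrix (Fin n) (Fin n) ℝ) (v : Fin n → ℝ) (i j : Fin n) :
    reducedAppraisal A v i j = A i j * v j / (A *ᵥ v) i := by
  simp only [reducedAppraisal, Matrix.mul_diagonal, Matrix.diagonal_mul]
  ring

theorem reducedAppraisal_one (hA : A ∈ Matrix.rowStochastic ℝ (Fin n)) :
    reducedAppraisal A 1 = A := by
  ext i j
  simp [reducedAppraisal_apply, Matrix.one_vecMul_of_mem_rowStochastic hA]

theorem reducedAppraisal_smul (A : Matrix (Fin n) (Fin n) ℝ) {c : ℝ} (hc : c ≠ 0)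
    (v : Fin n → ℝ) : reducedAppraisal A (c • v) = reducedAppraisal A v := by
  ext i j
  simp only [reducedAppraisal_apply, Matrix.mulVec_smul, Pi.smul_apply, smul_eq_mul,
    mul_left_comm _ c]
  exact mul_div_mul_left _ _ hc

theorem reducedAppraisal_mulVec (A : Matrix (Fin n) (Fin n) ℝ) (v u : Fin n → ℝ) (i : Fin n) :
    (reducedAppraisal A v *ᵥ u) i = (A *ᵥ (v * u)) i / (A *ᵥ v) i := by
  rw [Matrix.mulVec, Matrix.mulVec, dotProduct, dotProduct, Finset.sum_div]
  exact Finset.sum_congr rfl fun k _ => by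
    rw [reducedAppraisal_apply, Pi.mul_apply]
    ring

theorem reducedAppraisal_mem_rowStochastic (hA : A ∈ Matrix.rowStochastic ℝ (Fin n))
    {v : Fin n → ℝ} (hv : ∀ i, 0 < v i) :
    reducedAppraisal A v ∈ Matrix.rowStochastic ℝ (Fin n) := by
  refine ⟨fun i j => ?_, funext fun i => ?_⟩
  · rw [reducedAppraisal_apply]
    exact div_nonneg (mul_nonneg (hA.1 i j) (hv j).le) (mulVec_pos_of_mem_rowStochastic hA hv i).le
  · rw [reducedAppraisal_mulVec, mul_one, Pi.one_apply,
      div_self (mulVec_pos_of_mem_rowStochastic hA hv i).ne']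

theorem reducedAppraisal_reducedAppraisal (hA : A ∈ Matrix.rowStochastic ℝ (Fin n))
    {v : Fin n → ℝ} (hv : ∀ i, 0 < v i) (u : Fin n → ℝ) :
    reducedAppraisal (reducedAppraisal A v) u = reducedAppraisal A (v * u) := by
  ext i j
  have hZ := (mulVec_pos_of_mem_rowStochastic hA hv i).ne'
  rw [reducedAppraisal_apply, reducedAppraisal_mulVec, reducedAppraisal_apply,
    reducedAppraisal_apply, Pi.mul_apply, div_mul_eq_mul_div, div_div_div_cancel_right₀ hZ,
    mul_assoc]

theorem samePattern_reducedAppraisal (hA : A ∈ Matrix.rowStochastic ℝ (Fin n))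
    {v : Fin n → ℝ} (hv : ∀ i, 0 < v i) : SamePattern (reducedAppraisal A v) A := fun i j => by
  have hZ := mulVec_pos_of_mem_rowStochastic hA hv i
  rw [reducedAppraisal_apply, div_pos_iff_of_pos_right hZ, mul_pos_iff_of_pos_right (hv j)]
  simp [hZ.ne', (hv j).ne']

/-- The appraisal matrix reached from `A` once the cumulative performances are `y`: it is
`𝒜(exp y)`, so each row of `A` is reweighted by a softmax. -/
noncomputable def expAppraisal (A : Matrix (Fin n) (Fin n) ℝ) (y : Fin n → ℝ) :
    Matrix (Fin n) (Fin n) ℝ :=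
  reducedAppraisal A (Real.exp ∘ y)

theorem mulVec_exp_pos (hA : A ∈ Matrix.rowStochastic ℝ (Fin n)) (y : Fin n → ℝ) (i : Fin n) :
    0 < (A *ᵥ (Real.exp ∘ y)) i :=
  mulVec_pos_of_mem_rowStochastic hA (fun _ => Real.exp_pos _) i

theorem expAppraisal_apply (A : Matrix (Fin n) (Fin n) ℝ) (y : Fin n → ℝ) (i j : Fin n) :
    expAppraisal A y i j = A i j * Real.exp (y j) / (A *ᵥ (Real.exp ∘ y)) i :=
  reducedAppraisal_apply A _ i j

theorem expAppraisal_zero (hA : A ∈ Matrix.rowStochastic ℝ (Fin n)) : expAppraisal A 0 = A := by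
  have h : Real.exp ∘ (0 : Fin n → ℝ) = 1 := funext fun _ => Real.exp_zero
  rw [expAppraisal, h, reducedAppraisal_one hA]

theorem expAppraisal_sub_const (A : Matrix (Fin n) (Fin n) ℝ) (y : Fin n → ℝ) (c : ℝ) :
    expAppraisal A (fun i => y i - c) = expAppraisal A y := by
  have h : (Real.exp ∘ fun i => y i - c) = Real.exp (-c) • (Real.exp ∘ y) := funext fun i => by
    simp [sub_eq_neg_add, Real.exp_add]
  rw [expAppraisal, h, reducedAppraisal_smul A (Real.exp_pos _).ne', expAppraisal]

theorem expAppraisal_expAppraisal (hA : A ∈ Matrix.rowStochastic ℝ (Fin n)) (x y : Fin n → ℝ) :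
    expAppraisal (expAppraisal A x) y = expAppraisal A (x + y) := by
  have h : Real.exp ∘ (x + y) = (Real.exp ∘ x) * (Real.exp ∘ y) := funext fun i =>
    Real.exp_add _ _
  rw [expAppraisal, expAppraisal, expAppraisal, h]
  exact reducedAppraisal_reducedAppraisal hA (fun _ => Real.exp_pos _) _

theorem expAppraisal_mem_rowStochastic (hA : A ∈ Matrix.rowStochastic ℝ (Fin n))
    (y : Fin n → ℝ) : expAppraisal A y ∈ Matrix.rowStochastic ℝ (Fin n) :=
  reducedAppraisal_mem_rowStochastic hA fun _ => Real.exp_pos _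

theorem samePattern_expAppraisal (hA : A ∈ Matrix.rowStochastic ℝ (Fin n)) (y : Fin n → ℝ) :
    SamePattern (expAppraisal A y) A :=
  samePattern_reducedAppraisal hA fun _ => Real.exp_pos _

theorem mul_exp_neg_le_expAppraisal (hA : A ∈ Matrix.rowStochastic ℝ (Fin n)) {y : Fin n → ℝ}
    {M : ℝ} {j : Fin n} (hM : ∀ k, y k ≤ y j + M) (i : Fin n) :
    A i j * Real.exp (-M) ≤ expAppraisal A y i j := by
  have hZ : (A *ᵥ (Real.exp ∘ y)) i ≤ Real.exp (y j + M) :=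
    calc ∑ k, A i k * Real.exp (y k) ≤ ∑ k, A i k * Real.exp (y j + M) :=
          Finset.sum_le_sum fun k _ =>
            mul_le_mul_of_nonneg_left (Real.exp_le_exp.2 (hM k)) (hA.1 i k)
      _ = Real.exp (y j + M) := by
          rw [← Finset.sum_mul, Matrix.sum_row_of_mem_rowStochastic hA, one_mul]
  rw [expAppraisal_apply, le_div_iff₀ (mulVec_exp_pos hA y i)]
  calc A i j * Real.exp (-M) * (A *ᵥ (Real.exp ∘ y)) i
      ≤ A i j * Real.exp (-M) * Real.exp (y j + M) :=
        mul_le_mul_of_nonneg_left hZ (mul_nonneg (hA.1 i j) (Real.exp_pos _).le)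
    _ = A i j * Real.exp (y j) := by
        rw [mul_assoc, ← Real.exp_add, neg_add_eq_sub, add_sub_cancel_right]

theorem hasDerivWithinAt_mulVec_exp (hA : A ∈ Matrix.rowStochastic ℝ (Fin n))
    {y : ℝ → Fin n → ℝ} {q : Fin n → ℝ} {D : Set ℝ} {t : ℝ} (hy : HasDerivWithinAt y q D t)
    (i : Fin n) :
    HasDerivWithinAt (fun s => (A *ᵥ (Real.exp ∘ y s)) i)
      ((A *ᵥ (Real.exp ∘ y t)) i * (expAppraisal A (y t) *ᵥ q) i) D t := by
  refine (HasDerivWithinAt.fun_sum (u := Finset.univ) fun k _ =>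
    ((hasDerivWithinAt_pi.1 hy k).exp.const_mul (A i k))).congr_deriv ?_
  rw [expAppraisal, reducedAppraisal_mulVec, mul_div_cancel₀ _ (mulVec_exp_pos hA _ i).ne']
  rfl

theorem hasDerivWithinAt_expAppraisal (hA : A ∈ Matrix.rowStochastic ℝ (Fin n))
    {y : ℝ → Fin n → ℝ} {q : Fin n → ℝ} {D : Set ℝ} {t : ℝ} (hy : HasDerivWithinAt y q D t)
    (i j : Fin n) :
    HasDerivWithinAt (fun s => expAppraisal A (y s) i j)
      (expAppraisal A (y t) i j * (q j - (expAppraisal A (y t) *ᵥ q) i)) D t := by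
  have hZ := (mulVec_exp_pos hA (y t) i).ne'
  simp only [expAppraisal_apply A _ i j]
  refine (((hasDerivWithinAt_pi.1 hy j).exp.const_mul (A i j)).div
    (hasDerivWithinAt_mulVec_exp hA hy i) hZ).congr_deriv ?_
  field_simp

theorem lipschitzWith_expAppraisal (hA : A ∈ Matrix.rowStochastic ℝ (Fin n)) (i j : Fin n) :
    LipschitzWith 2 fun y => expAppraisal A y i j :=
  LipschitzWith.of_dist_le_mul fun y x => by
    set q := y - x with hq
    have hderiv : ∀ s ∈ Set.Icc (0 : ℝ) 1,
        HasDerivWithinAt (fun s : ℝ => expAppraisal A (x + s • q) i j)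
          (expAppraisal A (x + s • q) i j * (q j - (expAppraisal A (x + s • q) *ᵥ q) i))
          (Set.Icc 0 1) s := fun s _ =>
      hasDerivWithinAt_expAppraisal hA
        ((((hasDerivAt_id s).smul_const q).const_add x).hasDerivWithinAt.congr_deriv
          (one_smul ℝ q)) i j
    have hbound : ∀ s ∈ Set.Icc (0 : ℝ) 1, ‖expAppraisal A (x + s • q) i j *
        (q j - (expAppraisal A (x + s • q) *ᵥ q) i)‖ ≤ 2 * ‖q‖ := fun s _ => by
      have hS := expAppraisal_mem_rowStochastic hA (x + s • q)
      have h1 := norm_le_pi_norm q j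
      have h2 := (norm_le_pi_norm _ i).trans (norm_mulVec_le_of_mem_rowStochastic hS q)
      rw [norm_mul, Real.norm_of_nonneg (hS.1 i j)]
      exact (mul_le_of_le_one_left (norm_nonneg _) (Matrix.le_one_of_mem_rowStochastic hS)).trans
        ((norm_sub_le _ _).trans (by linarith))
    have h := (convex_Icc (0 : ℝ) 1).norm_image_sub_le_of_norm_hasDerivWithin_le hderiv hbound
      (Set.left_mem_Icc.2 zero_le_one) (Set.right_mem_Icc.2 zero_le_one)
    simpa [hq, dist_eq_norm] using h

theorem continuous_expAppraisal (hA : A ∈ Matrix.rowStochastic ℝ (Fin n)) :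
    Continuous (expAppraisal A) :=
  continuous_pi fun i => continuous_pi fun j => (lipschitzWith_expAppraisal hA i j).continuous

end Appraisal

section DonorFlow

variable {n : ℕ} {A : Matrix (Fin n) (Fin n) ℝ}

theorem donorFlow_eq_vecMul_sub (A : Matrix (Fin n) (Fin n) ℝ) (w : Fin n → ℝ) :
    donorFlow A w = w ᵥ* A - w := by
  ext i
  simp only [donorFlow, Pi.sub_apply, Matrix.vecMul, dotProduct, mul_comm (w _)]
  ring

theorem donorFlow_dotProduct (A : Matrix (Fin n) (Fin n) ℝ) (w q : Fin n → ℝ) :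
    donorFlow A w ⬝ᵥ q = w ⬝ᵥ A *ᵥ q - w ⬝ᵥ q := by
  rw [donorFlow_eq_vecMul_sub, sub_dotProduct, ← Matrix.dotProduct_mulVec]

theorem sum_donorFlow (hA : A ∈ Matrix.rowStochastic ℝ (Fin n)) (w : Fin n → ℝ) :
    ∑ i, donorFlow A w i = 0 := by
  rw [← dotProduct_one, donorFlow_dotProduct, Matrix.one_vecMul_of_mem_rowStochastic hA, sub_self]

theorem neg_le_donorFlow (hA : A ∈ Matrix.rowStochastic ℝ (Fin n)) {w : Fin n → ℝ}
    (hw : 0 ≤ w) (i : Fin n) : -w i ≤ donorFlow A w i :=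
  le_add_of_nonneg_right (Finset.sum_nonneg fun k _ => mul_nonneg (hA.1 k i) (hw k))

theorem norm_donorFlow_le (hA : A ∈ Matrix.rowStochastic ℝ (Fin n)) {w : Fin n → ℝ}
    (hw : w ∈ Set.Icc 0 1) : ‖donorFlow A w‖ ≤ 1 + n := by
  refine (pi_norm_le_iff_of_nonneg (by positivity)).2 fun i => ?_
  refine (norm_add_le _ _).trans (add_le_add ?_ ?_)
  · rw [norm_neg, Real.norm_of_nonneg (hw.1 i)]
    exact hw.2 i
  · refine (norm_sum_le_of_le Finset.univ (f := fun k => A k i * w k) (n := fun _ => 1)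
      fun k _ => ?_).trans (by simp)
    rw [Real.norm_of_nonneg (mul_nonneg (hA.1 k i) (hw.1 k))]
    exact mul_le_one₀ (Matrix.le_one_of_mem_rowStochastic hA) (hw.1 k) (hw.2 k)

theorem lipschitzOnWith_donorFlow_expAppraisal (hA : A ∈ Matrix.rowStochastic ℝ (Fin n)) :
    LipschitzOnWith (1 + 3 * n) (fun z : (Fin n → ℝ) × (Fin n → ℝ) =>
      donorFlow (expAppraisal A z.1) z.2) {z | z.2 ∈ Set.Icc 0 1} := by
  refine LipschitzOnWith.of_dist_le_mul fun z hz z' _ => ?_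
  refine (dist_pi_le_iff (by positivity)).2 fun i => ?_
  have hw : ∀ k, |z.2 k - z'.2 k| ≤ dist z z' := fun k =>
    (dist_le_pi_dist z.2 z'.2 k).trans (le_max_right _ _)
  have hterm : ∀ k, |expAppraisal A z.1 k i * z.2 k - expAppraisal A z'.1 k i * z'.2 k| ≤
      3 * dist z z' := fun k => by
    have hS := expAppraisal_mem_rowStochastic hA z'.1
    have hlip : |expAppraisal A z.1 k i - expAppraisal A z'.1 k i| ≤ 2 * dist z z' :=
      ((lipschitzWith_expAppraisal hA k i).dist_le_mul z.1 z'.1).trans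
        (mul_le_mul_of_nonneg_left (le_max_left _ _) zero_le_two)
    calc |expAppraisal A z.1 k i * z.2 k - expAppraisal A z'.1 k i * z'.2 k|
        = |(expAppraisal A z.1 k i - expAppraisal A z'.1 k i) * z.2 k +
            expAppraisal A z'.1 k i * (z.2 k - z'.2 k)| := by ring_nf
      _ ≤ |expAppraisal A z.1 k i - expAppraisal A z'.1 k i| * |z.2 k| +
            |expAppraisal A z'.1 k i| * |z.2 k - z'.2 k| := by
          rw [← abs_mul, ← abs_mul]
          exact abs_add_le _ _
      _ ≤ |expAppraisal A z.1 k i - expAppraisal A z'.1 k i| * 1 + 1 * |z.2 k - z'.2 k| := by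
          rw [abs_of_nonneg (hz.1 k), abs_of_nonneg (hS.1 k i)]
          gcongr
          · exact hz.2 k
          · exact Matrix.le_one_of_mem_rowStochastic hS
      _ ≤ 3 * dist z z' := by linarith [hw k]
  calc dist (donorFlow (expAppraisal A z.1) z.2 i) (donorFlow (expAppraisal A z'.1) z'.2 i)
      ≤ dist (z.2 i) (z'.2 i) + ∑ k, dist (expAppraisal A z.1 k i * z.2 k)
          (expAppraisal A z'.1 k i * z'.2 k) :=
        (dist_add_add_le _ _ _ _).trans
          (add_le_add (dist_neg_neg _ _).le (dist_sum_sum_le _ _ _))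
    _ ≤ dist z z' + ∑ _k : Fin n, 3 * dist z z' :=
        add_le_add (hw i) (Finset.sum_le_sum fun k _ => hterm k)
    _ = (1 + 3 * n : NNReal) * dist z z' := by simp; ring

end DonorFlow

section Simplex

variable {n : ℕ} {w : Fin n → ℝ}

theorem nonempty_of_mem_intSimplex (hw : w ∈ intSimplex n) : Nonempty (Fin n) := by
  by_contra! h
  simpa using hw.2

theorem mem_Ioc_of_mem_intSimplex (hw : w ∈ intSimplex n) (i : Fin n) : w i ∈ Set.Ioc (0 : ℝ) 1 :=
  ⟨hw.1 i, hw.2 ▸ Finset.single_le_sum (fun k _ => (hw.1 k).le) (Finset.mem_univ i)⟩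

theorem mem_Icc_of_mem_intSimplex (hw : w ∈ intSimplex n) : w ∈ Set.Icc 0 1 :=
  ⟨fun i => (hw.1 i).le, fun i => (mem_Ioc_of_mem_intSimplex hw i).2⟩

theorem exists_pos_forall_le_of_mem_intSimplex (hw : w ∈ intSimplex n) :
    ∃ ε ∈ Set.Ioc (0 : ℝ) 1, ∀ i, ε ≤ w i := by
  have := nonempty_of_mem_intSimplex hw
  obtain ⟨i, hi⟩ := Finite.exists_min w
  exact ⟨w i, mem_Ioc_of_mem_intSimplex hw i, hi⟩

end Simplex

/-! ### Cumulative trajectories -/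

section CumulativeTrajectory

variable {n : ℕ} {p : Fin n → ℝ → ℝ} {A : Matrix (Fin n) (Fin n) ℝ} {w₀ : Fin n → ℝ}

/-- The model rewritten in the cumulative performances `y(t) = ∫₀ᵗ p(w)`: the appraisal matrix is
recovered as `expAppraisal A y`, so the state is `(y, w)` instead of a matrix and a vector. -/
structure IsCumulativeTrajectory (p : Fin n → ℝ → ℝ) (A : Matrix (Fin n) (Fin n) ℝ)
    (w₀ : Fin n → ℝ) (y w : ℝ → Fin n → ℝ) : Prop where
  init_y : y 0 = 0
  init_w : w 0 = w₀
  mem_w : ∀ t ∈ Set.Ici 0, w t ∈ intSimplex n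
  deriv_y : ∀ t ∈ Set.Ici 0, HasDerivWithinAt y (perf p (w t)) (Set.Ici 0) t
  deriv_w : ∀ t ∈ Set.Ici 0,
    HasDerivWithinAt w (donorFlow (expAppraisal A (y t)) (w t)) (Set.Ici 0) t

/-- The field of the cumulative dynamics with the workloads truncated to `[c, 1]` in the
performances and to `[0, 1]` in the work flow, which makes it globally Lipschitz. -/
noncomputable def truncField (p : Fin n → ℝ → ℝ) (A : Matrix (Fin n) (Fin n) ℝ) (c : ℝ)
    (z : (Fin n → ℝ) × (Fin n → ℝ)) : (Fin n → ℝ) × (Fin n → ℝ) :=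
  (perf p ((fun _ => c) ⊔ (z.2 ⊓ 1)), donorFlow (expAppraisal A z.1) (0 ⊔ (z.2 ⊓ 1)))

theorem sup_inf_mem_Icc {α : Type*} [Lattice α] {a b : α} (hab : a ≤ b) (x : α) :
    a ⊔ (x ⊓ b) ∈ Set.Icc a b :=
  ⟨le_sup_left, sup_le hab inf_le_right⟩

theorem sup_inf_eq_of_mem_Icc {α : Type*} [Lattice α] {a b x : α} (hx : x ∈ Set.Icc a b) :
    a ⊔ (x ⊓ b) = x := by
  rw [inf_eq_left.2 hx.2, sup_eq_right.2 hx.1]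

theorem lipschitzWith_sup_inf {ι : Type*} [Fintype ι] (a b : ι → ℝ) :
    LipschitzWith 1 fun x : ι → ℝ => a ⊔ (x ⊓ b) :=
  LipschitzWith.of_dist_le_mul fun x x' => (dist_pi_le_iff (by positivity)).2 fun i => by
    refine (((LipschitzWith.id.min_const (b i)).const_max (a i)).dist_le_mul (x i) (x' i)).trans ?_
    exact mul_le_mul_of_nonneg_left (dist_le_pi_dist x x' i) zero_le_one

theorem exists_lipschitzOnWith_perf (hlip : ∀ i, LocallyLipschitzOn (Set.Ioc 0 1) (p i)) {c : ℝ}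
    (hc : 0 < c) : ∃ K, LipschitzOnWith K (perf p) (Set.Icc (fun _ => c) 1) := by
  choose K hK using fun i => ((hlip i).mono fun x (hx : x ∈ Set.Icc c 1) =>
    ⟨hc.trans_le hx.1, hx.2⟩).exists_lipschitzOnWith_of_compact isCompact_Icc
  refine ⟨Finset.univ.sup K, LipschitzOnWith.of_dist_le_mul fun x hx x' hx' =>
    (dist_pi_le_iff (by positivity)).2 fun i => ?_⟩
  refine ((hK i).dist_le_mul _ ⟨hx.1 i, hx.2 i⟩ _ ⟨hx'.1 i, hx'.2 i⟩).trans ?_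
  exact mul_le_mul (NNReal.coe_le_coe.2 (Finset.le_sup (Finset.mem_univ i)))
    (dist_le_pi_dist x x' i) dist_nonneg NNReal.zero_le_coe

theorem exists_lipschitzWith_truncField (hlip : ∀ i, LocallyLipschitzOn (Set.Ioc 0 1) (p i))
    (hA : A ∈ Matrix.rowStochastic ℝ (Fin n)) {c : ℝ} (hc : 0 < c) :
    ∃ K, ∀ d ∈ Set.Icc c 1, LipschitzWith K (truncField p A d) := by
  obtain ⟨K, hK⟩ := exists_lipschitzOnWith_perf hlip hc
  have hclamp : ∀ a : Fin n → ℝ, LipschitzWith 1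
      fun z : (Fin n → ℝ) × (Fin n → ℝ) => a ⊔ (z.2 ⊓ 1) := fun a => by
    simpa only [one_mul] using! (lipschitzWith_sup_inf a 1).comp LipschitzWith.prod_snd
  refine ⟨max K (1 + 3 * n), fun d hd => LipschitzWith.prodMk ?_ ?_⟩
  · have h := hK.comp (hclamp fun _ => d).lipschitzOnWith (s := Set.univ) fun z _ =>
      Set.Icc_subset_Icc_left (fun _ => hd.1) (sup_inf_mem_Icc (fun _ => hd.2) z.2)
    simpa only [mul_one, lipschitzOnWith_univ] using! h
  · have h := (lipschitzOnWith_donorFlow_expAppraisal hA).comp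
      (LipschitzWith.prod_fst.prodMk (hclamp 0)).lipschitzOnWith (s := Set.univ)
      fun z _ => sup_inf_mem_Icc zero_le_one z.2
    simpa only [mul_one, max_self, lipschitzOnWith_univ] using! h

theorem exists_norm_truncField_le (hlip : ∀ i, LocallyLipschitzOn (Set.Ioc 0 1) (p i))
    (hA : A ∈ Matrix.rowStochastic ℝ (Fin n)) {c : ℝ} (hc : 0 < c) :
    ∃ L : NNReal, ∀ d ∈ Set.Icc c 1, ∀ z, ‖truncField p A d z‖ ≤ L := by
  obtain ⟨K, hK⟩ := exists_lipschitzOnWith_perf hlip hc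
  obtain ⟨B, hB⟩ := isCompact_Icc.exists_bound_of_continuousOn hK.continuousOn
  refine ⟨(max B (1 + n)).toNNReal, fun d hd z => le_trans (max_le_max ?_ ?_) (le_max_left _ 0)⟩
  · exact hB _ (Set.Icc_subset_Icc_left (fun _ => hd.1) (sup_inf_mem_Icc (fun _ => hd.2) z.2))
  · exact norm_donorFlow_le (expAppraisal_mem_rowStochastic hA _) (sup_inf_mem_Icc zero_le_one z.2)

theorem continuousOn_truncField (hcont : ∀ i, ContinuousOn (p i) (Set.Ioc 0 1))
    (z : (Fin n → ℝ) × (Fin n → ℝ)) :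
    ContinuousOn (fun c => truncField p A c z) (Set.Ioc 0 1) := by
  refine ContinuousOn.prodMk (continuousOn_pi.2 fun i => ?_) continuousOn_const
  refine (hcont i).comp (f := fun c => c ⊔ (z.2 i ⊓ 1)) (by fun_prop) fun c hc => ?_
  exact ⟨hc.1.trans_le le_sup_left, sup_le hc.2 inf_le_right⟩

theorem truncField_eq {c : ℝ} {z : (Fin n → ℝ) × (Fin n → ℝ)} (hc : ∀ i, c ≤ z.2 i)
    (hz : z.2 ∈ Set.Icc 0 1) :
    truncField p A c z = (perf p z.2, donorFlow (expAppraisal A z.1) z.2) := by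
  rw [truncField, sup_inf_eq_of_mem_Icc hz, sup_inf_eq_of_mem_Icc ⟨hc, hz.2⟩]

theorem mul_exp_neg_two_mul_mem_Icc {ε : ℝ} (hε : ε ∈ Set.Ioc 0 1) {t b : ℝ}
    (ht : t ∈ Set.Icc 0 b) : ε * Real.exp (-2 * t) ∈ Set.Icc (ε * Real.exp (-2 * b)) 1 :=
  ⟨mul_le_mul_of_nonneg_left (Real.exp_le_exp.2 (by linarith [ht.2])) hε.1.le,
    mul_le_one₀ hε.2 (Real.exp_pos _).le (Real.exp_le_one_iff.2 (by linarith [ht.1]))⟩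

theorem IsCumulativeTrajectory.hasDerivWithinAt_truncField
    (hA : A ∈ Matrix.rowStochastic ℝ (Fin n)) {y w : ℝ → Fin n → ℝ}
    (h : IsCumulativeTrajectory p A w₀ y w) {ε : ℝ} (hε : 0 < ε) (hw₀ : ∀ i, ε ≤ w₀ i) {t : ℝ}
    (ht : t ∈ Set.Ici 0) :
    HasDerivWithinAt (fun t => (y t, w t))
      (truncField p A (ε * Real.exp (-2 * t)) (y t, w t)) (Set.Ici 0) t := by
  have hlow : ∀ i, ε * Real.exp (-2 * t) ≤ w t i := fun i =>
    mul_exp_neg_two_mul_le hε (f := fun t => w t i) (h.init_w.symm ▸ hw₀ i)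
      (fun s hs => hasDerivWithinAt_pi.1 (h.deriv_w s hs) i)
      (fun s hs _ => neg_le_donorFlow (expAppraisal_mem_rowStochastic hA _)
        (mem_Icc_of_mem_intSimplex (h.mem_w s hs)).1 i) ht
  rw [truncField_eq hlow (mem_Icc_of_mem_intSimplex (h.mem_w t ht))]
  exact (h.deriv_y t ht).prodMk (h.deriv_w t ht)

theorem IsCumulativeTrajectory.eqOn (hlip : ∀ i, LocallyLipschitzOn (Set.Ioc 0 1) (p i))
    (hA : A ∈ Matrix.rowStochastic ℝ (Fin n)) {y w y' w' : ℝ → Fin n → ℝ}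
    (h : IsCumulativeTrajectory p A w₀ y w) (h' : IsCumulativeTrajectory p A w₀ y' w') :
    Set.EqOn (fun t => (y t, w t)) (fun t => (y' t, w' t)) (Set.Ici 0) := by
  obtain ⟨ε, hε, hw₀⟩ := exists_pos_forall_le_of_mem_intSimplex (h.mem_w 0 Set.self_mem_Ici)
  rw [h.init_w] at hw₀
  refine eqOn_Ici_of_hasDerivWithinAt (f := fun t => truncField p A (ε * Real.exp (-2 * t)))
    (fun b _ => ?_) (fun t ht => h.hasDerivWithinAt_truncField hA hε.1 hw₀ ht)
    (fun t ht => h'.hasDerivWithinAt_truncField hA hε.1 hw₀ ht)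
    (by simp only [h.init_y, h.init_w, h'.init_y, h'.init_w])
  obtain ⟨K, hK⟩ := exists_lipschitzWith_truncField hlip hA (mul_pos hε.1 (Real.exp_pos (-2 * b)))
  exact ⟨K, fun t ht => hK _ (mul_exp_neg_two_mul_mem_Icc hε ht)⟩

theorem mul_exp_neg_two_mul_le_of_hasDerivWithinAt_truncField
    (hA : A ∈ Matrix.rowStochastic ℝ (Fin n)) {ε : ℝ} (hε : ε ∈ Set.Ioc 0 1)
    {z : ℝ → (Fin n → ℝ) × (Fin n → ℝ)} (hz₀ : ∀ i, ε ≤ (z 0).2 i)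
    (hz : ∀ t ∈ Set.Ici 0,
      HasDerivWithinAt z (truncField p A (ε * Real.exp (-2 * t)) (z t)) (Set.Ici 0) t)
    {t : ℝ} (ht : 0 ≤ t) (i : Fin n) : ε * Real.exp (-2 * t) ≤ (z t).2 i := by
  refine mul_exp_neg_two_mul_le hε.1 (f := fun t => (z t).2 i) (hz₀ i)
    (fun s hs => hasDerivWithinAt_pi.1 (hasFDerivAt_snd.comp_hasDerivWithinAt s (hz s hs)) i)
    (fun s hs hmeet => ?_) ht
  have htrunc : (0 ⊔ ((z s).2 ⊓ 1) : Fin n → ℝ) i = (z s).2 i :=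
    sup_inf_eq_of_mem_Icc (b := (1 : ℝ)) (by
      rw [hmeet]
      exact ⟨(mul_pos hε.1 (Real.exp_pos _)).le, (mul_exp_neg_two_mul_mem_Icc hε ⟨hs, le_rfl⟩).2⟩)
  exact htrunc ▸ neg_le_donorFlow (expAppraisal_mem_rowStochastic hA (z s).1)
    (w := 0 ⊔ ((z s).2 ⊓ 1)) le_sup_left i

theorem sum_snd_eq_of_hasDerivWithinAt_truncField (hA : A ∈ Matrix.rowStochastic ℝ (Fin n))
    {c : ℝ → ℝ} {z : ℝ → (Fin n → ℝ) × (Fin n → ℝ)}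
    (hz : ∀ t ∈ Set.Ici 0, HasDerivWithinAt z (truncField p A (c t) (z t)) (Set.Ici 0) t)
    {t : ℝ} (ht : 0 ≤ t) : ∑ i, (z t).2 i = ∑ i, (z 0).2 i :=
  eqOn_const_of_forall_hasDerivWithinAt_zero (convex_Ici 0) (f := fun t => ∑ i, (z t).2 i)
    (fun s hs => (HasDerivWithinAt.fun_sum fun i _ => hasDerivWithinAt_pi.1
      (hasFDerivAt_snd.comp_hasDerivWithinAt s (hz s hs)) i).congr_deriv
        (sum_donorFlow (expAppraisal_mem_rowStochastic hA _) _)) ht Set.self_mem_Ici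

theorem exists_isCumulativeTrajectory (hlip : ∀ i, LocallyLipschitzOn (Set.Ioc 0 1) (p i))
    (hA : A ∈ Matrix.rowStochastic ℝ (Fin n)) (hw₀ : w₀ ∈ intSimplex n) :
    ∃ y w, IsCumulativeTrajectory p A w₀ y w := by
  obtain ⟨ε, hε, hεw⟩ := exists_pos_forall_le_of_mem_intSimplex hw₀
  have hlevel : ∀ b, 0 < ε * Real.exp (-2 * b) := fun b => mul_pos hε.1 (Real.exp_pos _)
  obtain ⟨z, hz₀, hz⟩ := exists_hasDerivWithinAt_Ici (a := 0)
    (f := fun t => truncField p A (ε * Real.exp (-2 * t)))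
    (fun b _ => (exists_lipschitzWith_truncField hlip hA (hlevel b)).imp
      fun K hK t ht => hK _ (mul_exp_neg_two_mul_mem_Icc hε ht))
    (fun b _ => (exists_norm_truncField_le hlip hA (hlevel b)).imp
      fun L hL t ht => hL _ (mul_exp_neg_two_mul_mem_Icc hε ht))
    (fun z => (continuousOn_truncField (fun i => (hlip i).continuousOn) z).comp (by fun_prop)
      fun t ht => ⟨hlevel t, (mul_exp_neg_two_mul_mem_Icc hε ⟨ht, le_rfl⟩).2⟩) (0, w₀)
  have hlow : ∀ t ∈ Set.Ici 0, ∀ i, ε * Real.exp (-2 * t) ≤ (z t).2 i := fun t ht =>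
    mul_exp_neg_two_mul_le_of_hasDerivWithinAt_truncField hA hε (by simpa [hz₀] using hεw) hz ht
  have hmem : ∀ t ∈ Set.Ici 0, (z t).2 ∈ intSimplex n := fun t ht =>
    ⟨fun i => (hlevel t).trans_le (hlow t ht i),
      (sum_snd_eq_of_hasDerivWithinAt_truncField hA hz ht).trans (by rw [hz₀]; exact hw₀.2)⟩
  have hderiv : ∀ t ∈ Set.Ici 0, HasDerivWithinAt z
      (perf p (z t).2, donorFlow (expAppraisal A (z t).1) (z t).2) (Set.Ici 0) t := fun t ht => by
    rw [← truncField_eq (hlow t ht) (mem_Icc_of_mem_intSimplex (hmem t ht))]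
    exact hz t ht
  exact ⟨fun t => (z t).1, fun t => (z t).2, by rw [hz₀], by rw [hz₀], hmem,
    fun t ht => (hasFDerivAt_fst (p := z t)).comp_hasDerivWithinAt t (hderiv t ht),
    fun t ht => (hasFDerivAt_snd (p := z t)).comp_hasDerivWithinAt t (hderiv t ht)⟩

end CumulativeTrajectory

/-! ### Equivalence with the full and the reduced-order dynamics -/

section Replicator

variable {ι : Type*} [Fintype ι] {a q : ℝ → ι → ℝ}

theorem exists_hasDerivWithinAt_dotProduct
    (ha : ContinuousOn a (Set.Ici 0)) (hq : ContinuousOn q (Set.Ici 0)) :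
    ∃ Φ : ℝ → ℝ, Φ 0 = 0 ∧
      ∀ t ∈ Set.Ici 0, HasDerivWithinAt Φ (a t ⬝ᵥ q t) (Set.Ici 0) t :=
  ⟨_, intervalIntegral.integral_same, fun _ ht => hasDerivWithinAt_integral_Ici
    (continuousOn_finsetSum _ fun i _ => (continuousOn_pi.1 ha i).mul (continuousOn_pi.1 hq i)) ht⟩

theorem eq_div_of_replicator (hq : ContinuousOn q (Set.Ici 0)) {y : ℝ → ι → ℝ} (hy₀ : y 0 = 0)
    (hy : ∀ t ∈ Set.Ici 0, HasDerivWithinAt y (q t) (Set.Ici 0) t)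
    (ha₀ : ∑ j, a 0 j = 1)
    (ha : ∀ t ∈ Set.Ici 0, ∀ j,
      HasDerivWithinAt (fun s => a s j) (a t j * (q t j - a t ⬝ᵥ q t)) (Set.Ici 0) t)
    {t : ℝ} (ht : t ∈ Set.Ici 0) (j : ι) :
    a t j = a 0 j * Real.exp (y t j) / (a 0 ⬝ᵥ Real.exp ∘ y t) := by
  obtain ⟨Φ, hΦ₀, hΦ⟩ := exists_hasDerivWithinAt_dotProduct
    (fun s hs => (hasDerivWithinAt_pi.2 (ha s hs)).continuousWithinAt) hq
  have hform : ∀ j, a t j = a 0 j * Real.exp (y t j - Φ t) := fun j => by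
    have h := eq_mul_exp_of_forall_hasDerivWithinAt (convex_Ici 0) (fun s hs => ha s hs j)
      (fun s hs => (hasDerivWithinAt_pi.1 (hy s hs) j).fun_sub (hΦ s hs)) Set.self_mem_Ici ht
    simpa [hy₀, hΦ₀] using h
  have hdefect : ∀ s ∈ Set.Ici 0, HasDerivWithinAt (fun s => 1 - ∑ j, a s j)
      ((1 - ∑ j, a s j) * -(a s ⬝ᵥ q s)) (Set.Ici 0) s := fun s hs => by
    refine ((HasDerivWithinAt.fun_sum (u := Finset.univ) fun j _ => ha s hs j).const_sub
      1).congr_deriv ?_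
    simp only [mul_sub, Finset.sum_sub_distrib, ← Finset.sum_mul]
    rw [← dotProduct]
    ring
  have hsum : ∑ j, a t j = 1 := by
    have h := eq_mul_exp_of_forall_hasDerivWithinAt (convex_Ici 0) hdefect
      (fun s hs => (hΦ s hs).fun_neg) Set.self_mem_Ici ht
    rw [ha₀, sub_self, zero_mul] at h
    exact (sub_eq_zero.1 h).symm
  have hexp : a 0 ⬝ᵥ Real.exp ∘ y t = Real.exp (Φ t) := by
    simp only [hform, Real.exp_sub, ← mul_div_assoc, ← Finset.sum_div] at hsum
    exact (div_eq_one_iff_eq (Real.exp_pos _).ne').1 hsum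
  rw [hexp, hform, Real.exp_sub, mul_div_assoc]

end Replicator

section Conversion

variable {n : ℕ} {p : Fin n → ℝ → ℝ} {A₀ : Matrix (Fin n) (Fin n) ℝ} {w₀ : Fin n → ℝ}

theorem continuousOn_perf (hcont : ∀ i, ContinuousOn (p i) (Set.Ioc 0 1)) {w : ℝ → Fin n → ℝ}
    {D : Set ℝ} (hw : ContinuousOn w D) (hmem : ∀ t ∈ D, ∀ i, w t i ∈ Set.Ioc (0 : ℝ) 1) :
    ContinuousOn (fun t => perf p (w t)) D :=
  continuousOn_pi.2 fun i => (hcont i).comp (continuousOn_pi.1 hw i) fun t ht => hmem t ht i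

theorem IsASAPTrajectory.exists_isCumulativeTrajectory
    (hcont : ∀ i, ContinuousOn (p i) (Set.Ioc 0 1)) (hA : A₀ ∈ Matrix.rowStochastic ℝ (Fin n))
    (hw₀ : w₀ ∈ intSimplex n) {A : ℝ → Matrix (Fin n) (Fin n) ℝ} {w : ℝ → Fin n → ℝ}
    (h : IsASAPTrajectory p A₀ w₀ A w) :
    ∃ y, IsCumulativeTrajectory p A₀ w₀ y w ∧ ∀ t ∈ Set.Ici 0, A t = expAppraisal A₀ (y t) := by
  have hw : ∀ t ∈ Set.Ici 0, HasDerivWithinAt w (donorFlow (A t) (w t)) (Set.Ici 0) t :=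
    fun t ht => hasDerivWithinAt_pi.2 (h.deriv_w t ht)
  have hperf := continuousOn_perf hcont (fun t ht => (hw t ht).continuousWithinAt) h.mem_domain
  set y : ℝ → Fin n → ℝ := fun t => ∫ s in 0..t, perf p (w s)
  have hy₀ : y 0 = 0 := intervalIntegral.integral_same
  have hy : ∀ t ∈ Set.Ici 0, HasDerivWithinAt y (perf p (w t)) (Set.Ici 0) t := fun t ht =>
    hasDerivWithinAt_integral_Ici hperf ht
  have hAy : ∀ t ∈ Set.Ici 0, A t = expAppraisal A₀ (y t) := fun t ht => by
    ext i j
    rw [expAppraisal_apply, eq_div_of_replicator (a := fun t => A t i) hperf hy₀ hy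
      (by rw [h.init_A, Matrix.sum_row_of_mem_rowStochastic hA]) (fun s hs => h.deriv_A s hs i) ht,
      h.init_A, Matrix.mulVec]
  have hsum : ∀ t ∈ Set.Ici 0, ∑ i, w t i = 1 := fun t ht => by
    have hconst := eqOn_const_of_forall_hasDerivWithinAt_zero (convex_Ici 0)
      (f := fun t => ∑ i, w t i) (fun s hs => (HasDerivWithinAt.fun_sum (u := Finset.univ)
        fun i _ => h.deriv_w s hs i).congr_deriv (by
          rw [hAy s hs]
          exact sum_donorFlow (expAppraisal_mem_rowStochastic hA _) _)) ht Set.self_mem_Ici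
    rw [hconst, h.init_w, hw₀.2]
  exact ⟨y, ⟨hy₀, h.init_w, fun t ht => ⟨fun i => (h.mem_domain t ht i).1, hsum t ht⟩, hy,
    fun t ht => hAy t ht ▸ hw t ht⟩, hAy⟩

theorem IsCumulativeTrajectory.isASAPTrajectory (hA : A₀ ∈ Matrix.rowStochastic ℝ (Fin n))
    {y w : ℝ → Fin n → ℝ} (h : IsCumulativeTrajectory p A₀ w₀ y w) :
    IsASAPTrajectory p A₀ w₀ (fun t => expAppraisal A₀ (y t)) w where
  init_A := by rw [h.init_y, expAppraisal_zero hA]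
  init_w := h.init_w
  mem_domain t ht := mem_Ioc_of_mem_intSimplex (h.mem_w t ht)
  deriv_A t ht := hasDerivWithinAt_expAppraisal hA (h.deriv_y t ht)
  deriv_w t ht := hasDerivWithinAt_pi.1 (h.deriv_w t ht)

theorem reducedAppraisal_exp_sub (A : Matrix (Fin n) (Fin n) ℝ) (y : Fin n → ℝ) (c : ℝ) :
    reducedAppraisal A (fun i => Real.exp (y i - c)) = expAppraisal A y :=
  expAppraisal_sub_const A y c

theorem IsReducedTrajectory.exists_isCumulativeTrajectory
    (hcont : ∀ i, ContinuousOn (p i) (Set.Ioc 0 1)) {v w : ℝ → Fin n → ℝ}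
    (h : IsReducedTrajectory p A₀ w₀ v w) :
    ∃ y Θ, IsCumulativeTrajectory p A₀ w₀ y w ∧
      (∀ t ∈ Set.Ici 0, HasDerivWithinAt Θ
        (w t ⬝ᵥ expAppraisal A₀ (y t) *ᵥ perf p (w t)) (Set.Ici 0) t) ∧
      ∀ t ∈ Set.Ici 0, ∀ i, v t i = Real.exp (y t i - Θ t) := by
  have hw : ∀ t ∈ Set.Ici 0,
      HasDerivWithinAt w (donorFlow (reducedAppraisal A₀ (v t)) (w t)) (Set.Ici 0) t :=
    fun t ht => hasDerivWithinAt_pi.2 (h.deriv_w t ht)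
  have hperf := continuousOn_perf hcont (fun t ht => (hw t ht).continuousWithinAt)
    fun t ht => mem_Ioc_of_mem_intSimplex (h.mem_w t ht)
  set y : ℝ → Fin n → ℝ := fun t => ∫ s in 0..t, perf p (w s)
  have hy₀ : y 0 = 0 := intervalIntegral.integral_same
  have hy : ∀ t ∈ Set.Ici 0, HasDerivWithinAt y (perf p (w t)) (Set.Ici 0) t := fun t ht =>
    hasDerivWithinAt_integral_Ici hperf ht
  obtain ⟨k⟩ := nonempty_of_mem_intSimplex (h.mem_w 0 le_rfl)
  set Θ : ℝ → ℝ := fun t => y t k - Real.log (v t k) with hΘ_def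
  have hΘ : ∀ t ∈ Set.Ici 0, HasDerivWithinAt Θ
      (w t ⬝ᵥ reducedAppraisal A₀ (v t) *ᵥ perf p (w t)) (Set.Ici 0) t := fun t ht =>
    ((hasDerivWithinAt_pi.1 (hy t ht) k).fun_sub
      ((h.deriv_v t ht k).log (h.pos_v t ht k).ne')).congr_deriv (by
        rw [mul_div_cancel_right₀ _ (h.pos_v t ht k).ne', sub_sub_cancel])
  have hv : ∀ t ∈ Set.Ici 0, ∀ i, v t i = Real.exp (y t i - Θ t) := fun t ht i => by
    have hexp := eq_mul_exp_of_forall_hasDerivWithinAt (convex_Ici 0)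
      (fun s hs => (h.deriv_v s hs i).congr_deriv (mul_comm _ _))
      (fun s hs => (hasDerivWithinAt_pi.1 (hy s hs) i).fun_sub (hΘ s hs)) Set.self_mem_Ici ht
    simpa [hy₀, hΘ_def, h.init_v] using hexp
  have hvy : ∀ t ∈ Set.Ici 0, reducedAppraisal A₀ (v t) = expAppraisal A₀ (y t) := fun t ht => by
    rw [funext (hv t ht), reducedAppraisal_exp_sub]
  exact ⟨y, Θ, ⟨hy₀, h.init_w, h.mem_w, hy, fun t ht => hvy t ht ▸ hw t ht⟩,
    fun t ht => hvy t ht ▸ hΘ t ht, hv⟩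

theorem IsCumulativeTrajectory.continuousOn_perf (hcont : ∀ i, ContinuousOn (p i) (Set.Ioc 0 1))
    {y w : ℝ → Fin n → ℝ} (h : IsCumulativeTrajectory p A₀ w₀ y w) :
    ContinuousOn (fun t => perf p (w t)) (Set.Ici 0) :=
  _root_.continuousOn_perf hcont (fun t ht => (h.deriv_w t ht).continuousWithinAt)
    fun t ht => mem_Ioc_of_mem_intSimplex (h.mem_w t ht)

theorem IsCumulativeTrajectory.exists_hasDerivWithinAt_dotProduct_perf
    (hcont : ∀ i, ContinuousOn (p i) (Set.Ioc 0 1)) {y w : ℝ → Fin n → ℝ}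
    (h : IsCumulativeTrajectory p A₀ w₀ y w) :
    ∃ z : ℝ → ℝ, z 0 = 0 ∧
      ∀ t ∈ Set.Ici 0, HasDerivWithinAt z (w t ⬝ᵥ perf p (w t)) (Set.Ici 0) t :=
  exists_hasDerivWithinAt_dotProduct (fun t ht => (h.deriv_w t ht).continuousWithinAt)
    (h.continuousOn_perf hcont)

theorem IsCumulativeTrajectory.exists_hasDerivWithinAt_dotProduct_mulVec_perf
    (hcont : ∀ i, ContinuousOn (p i) (Set.Ioc 0 1)) (hA : A₀ ∈ Matrix.rowStochastic ℝ (Fin n))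
    {y w : ℝ → Fin n → ℝ} (h : IsCumulativeTrajectory p A₀ w₀ y w) :
    ∃ Θ : ℝ → ℝ, Θ 0 = 0 ∧ ∀ t ∈ Set.Ici 0, HasDerivWithinAt Θ
      (w t ⬝ᵥ expAppraisal A₀ (y t) *ᵥ perf p (w t)) (Set.Ici 0) t := by
  have hy : ContinuousOn y (Set.Ici 0) := fun t ht => (h.deriv_y t ht).continuousWithinAt
  refine exists_hasDerivWithinAt_dotProduct (fun t ht => (h.deriv_w t ht).continuousWithinAt)
    (continuousOn_pi.2 fun i => ?_)
  simp only [Matrix.mulVec, dotProduct]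
  exact continuousOn_finsetSum _ fun j _ =>
    (((continuous_expAppraisal hA).matrix_elem i j).comp_continuousOn hy).mul
      (continuousOn_pi.1 (h.continuousOn_perf hcont) j)

theorem IsCumulativeTrajectory.isReducedTrajectory {y w : ℝ → Fin n → ℝ}
    (h : IsCumulativeTrajectory p A₀ w₀ y w) {Θ : ℝ → ℝ} (hΘ₀ : Θ 0 = 0)
    (hΘ : ∀ t ∈ Set.Ici 0, HasDerivWithinAt Θ
      (w t ⬝ᵥ expAppraisal A₀ (y t) *ᵥ perf p (w t)) (Set.Ici 0) t) :
    IsReducedTrajectory p A₀ w₀ (fun t i => Real.exp (y t i - Θ t)) w where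
  init_v := by simp [h.init_y, hΘ₀]
  init_w := h.init_w
  pos_v t _ i := Real.exp_pos _
  mem_w := h.mem_w
  deriv_v t ht i := by
    rw [reducedAppraisal_exp_sub]
    exact ((hasDerivWithinAt_pi.1 (h.deriv_y t ht) i).fun_sub (hΘ t ht)).exp.congr_deriv
      (mul_comm _ _)
  deriv_w t ht i := by
    rw [reducedAppraisal_exp_sub]
    exact hasDerivWithinAt_pi.1 (h.deriv_w t ht) i

end Conversion

/-! ### The optimal workload -/

section Optimum

variable {n : ℕ} {p : Fin n → ℝ → ℝ}

theorem continuousOn_of_strictAntiOn_of_rightInvOn {α β : Type*}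
    [LinearOrder α] [TopologicalSpace α] [OrderTopology α]
    [LinearOrder β] [TopologicalSpace β] [OrderTopology β]
    {f : α → β} {g : β → α} {s : Set α} {t : Set β} (hf : StrictAntiOn f s) (hs : s.OrdConnected)
    (hg : Set.MapsTo g t s) (hfg : Set.RightInvOn g f t) : ContinuousOn g t := by
  refine fun c hc => tendsto_order.2 ⟨fun b hb => ?_, fun b hb => ?_⟩
  · by_cases hbs : b ∈ s
    · have hcb : c < f b := hfg hc ▸ hf hbs (hg hc) hb
      filter_upwards [self_mem_nhdsWithin, mem_nhdsWithin_of_mem_nhds (Iio_mem_nhds hcb)]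
        with d hd hdb
      exact (hf.lt_iff_gt (hg hd) hbs).1 (by rwa [hfg hd])
    · filter_upwards [self_mem_nhdsWithin] with d hd
      by_contra! hdb
      exact hbs (hs.out (hg hd) (hg hc) ⟨hdb, hb.le⟩)
  · by_cases hbs : b ∈ s
    · have hbc : f b < c := hfg hc ▸ hf (hg hc) hbs hb
      filter_upwards [self_mem_nhdsWithin, mem_nhdsWithin_of_mem_nhds (Ioi_mem_nhds hbc)]
        with d hd hdb
      exact (hf.lt_iff_gt hbs (hg hd)).1 (by rwa [hfg hd])
    · filter_upwards [self_mem_nhdsWithin] with d hd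
      by_contra! hdb
      exact hbs (hs.out (hg hc) (hg hd) ⟨hb.le, hdb⟩)

theorem exists_mem_Ioc_eq_of_tendsto_atTop {f : ℝ → ℝ} (hf : ContinuousOn f (Set.Ioc 0 1))
    (hlim : Tendsto f (𝓝[>] 0) atTop) {c : ℝ} (hc : f 1 ≤ c) : ∃ x ∈ Set.Ioc 0 1, f x = c :=
  isPreconnected_Ioc.intermediate_value_Ici (Set.right_mem_Ioc.2 one_pos)
    (le_principal_iff.2 (Ioc_mem_nhdsGT one_pos)) hf hlim hc

theorem IsOptimalPair.fst_le (hanti : ∀ i, StrictAntiOn (p i) (Set.Ioc 0 1))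
    {q q' : ℝ × (Fin n → ℝ)} (h : IsOptimalPair p q) (h' : IsOptimalPair p q') : q.1 ≤ q'.1 := by
  by_contra! hlt
  have := nonempty_of_mem_intSimplex h.2.1
  have hi : ∀ i, q.2 i < q'.2 i := fun i => by
    refine ((hanti i).lt_iff_gt (mem_Ioc_of_mem_intSimplex h'.2.1 i)
      (mem_Ioc_of_mem_intSimplex h.2.1 i)).1 ?_
    calc p i (q'.2 i) = q'.1 := congrFun h'.2.2 i
      _ < q.1 := hlt
      _ = p i (q.2 i) := (congrFun h.2.2 i).symm
  have hsum := Finset.sum_lt_sum_of_nonempty Finset.univ_nonempty fun i _ => hi i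
  exact hsum.ne (h.2.1.2.trans h'.2.1.2.symm)

theorem IsOptimalPair.unique (hanti : ∀ i, StrictAntiOn (p i) (Set.Ioc 0 1))
    {q q' : ℝ × (Fin n → ℝ)} (h : IsOptimalPair p q) (h' : IsOptimalPair p q') : q = q' := by
  have hfst : q.1 = q'.1 := (h.fst_le hanti h').antisymm (h'.fst_le hanti h)
  refine Prod.ext hfst (funext fun i => (hanti i).injOn (mem_Ioc_of_mem_intSimplex h.2.1 i)
    (mem_Ioc_of_mem_intSimplex h'.2.1 i) ?_)
  exact (congrFun h.2.2 i).trans (hfst.trans (congrFun h'.2.2 i).symm)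

theorem exists_mem_intSimplex_perf_eq_const [Nonempty (Fin n)]
    (hcont : ∀ i, ContinuousOn (p i) (Set.Ioc 0 1))
    (hanti : ∀ i, StrictAntiOn (p i) (Set.Ioc 0 1))
    (hlim : ∀ i, Tendsto (p i) (𝓝[>] 0) atTop) :
    ∃ c, ∃ w ∈ intSimplex n, perf p w = fun _ => c := by
  have hn : (1 : ℝ) ≤ n := by exact_mod_cast Fin.pos_iff_nonempty.2 ‹_›
  have hn₀ : (0 : ℝ) < n := one_pos.trans_le hn
  have hmem₁ : (1 : ℝ) ∈ Set.Ioc (0 : ℝ) 1 := Set.right_mem_Ioc.2 one_pos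
  have hmem : (1 / n : ℝ) ∈ Set.Ioc (0 : ℝ) 1 := ⟨by positivity, (div_le_one hn₀).2 hn⟩
  obtain ⟨k, hk⟩ := Finite.exists_max fun i => p i 1
  obtain ⟨l, hl⟩ := Finite.exists_max fun i => p i (1 / n)
  choose! g hg hpg using fun i c (hc : c ∈ Set.Ici (p k 1)) =>
    exists_mem_Ioc_eq_of_tendsto_atTop (hcont i) (hlim i) ((hk i).trans hc)
  have hsum_cont : ContinuousOn (fun c => ∑ i, g i c) (Set.Ici (p k 1)) :=
    continuousOn_finsetSum _ fun i _ =>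
      continuousOn_of_strictAntiOn_of_rightInvOn (hanti i) Set.ordConnected_Ioc (hg i) (hpg i)
  have hkl : p k 1 ≤ p l (1 / n) := ((hanti k).antitoneOn hmem hmem₁ hmem.2).trans (hl k)
  have hlower : 1 ≤ ∑ i, g i (p k 1) :=
    calc (1 : ℝ) = g k (p k 1) :=
          (hanti k).injOn hmem₁ (hg k _ Set.self_mem_Ici) (hpg k _ Set.self_mem_Ici).symm
      _ ≤ _ := Finset.single_le_sum (f := fun i => g i (p k 1))
        (fun i _ => (hg i _ Set.self_mem_Ici).1.le) (Finset.mem_univ k)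
  have hupper : ∑ i, g i (p l (1 / n)) ≤ 1 :=
    calc ∑ i, g i (p l (1 / n)) ≤ ∑ _i : Fin n, (1 / n : ℝ) := Finset.sum_le_sum fun i _ =>
          ((hanti i).le_iff_ge hmem (hg i _ hkl)).1 ((hpg i _ hkl).symm ▸ hl i)
      _ = 1 := by simp [hn₀.ne']
  obtain ⟨c, hc, hc₁⟩ :=
    intermediate_value_Icc' hkl (hsum_cont.mono Set.Icc_subset_Ici_self) ⟨hupper, hlower⟩
  exact ⟨c, fun i => g i c, ⟨fun i => (hg i c hc.1).1, hc₁⟩, funext fun i => hpg i c hc.1⟩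

theorem existsUnique_isOptimalPair [Nonempty (Fin n)]
    (hcont : ∀ i, ContinuousOn (p i) (Set.Ioc 0 1))
    (hanti : ∀ i, StrictAntiOn (p i) (Set.Ioc 0 1))
    (hlim : ∀ i, Tendsto (p i) (𝓝[>] 0) atTop)
    (hpos : ∀ w ∈ intSimplex n, ∀ i, 0 < p i (w i)) : ∃! q, IsOptimalPair p q := by
  obtain ⟨c, w, hw, hc⟩ := exists_mem_intSimplex_perf_eq_const hcont hanti hlim
  obtain ⟨i⟩ := ‹Nonempty (Fin n)›
  have hopt : IsOptimalPair p (c, w) := ⟨congrFun hc i ▸ hpos w hw i, hw, hc⟩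
  exact ⟨(c, w), hopt, fun q hq => hq.unique hanti hopt⟩

end Optimum

/-! ### Irreducible row-stochastic matrices and their stationary tilts -/

section Irreducible

variable {n : ℕ} {A B : Matrix (Fin n) (Fin n) ℝ} {w x : Fin n → ℝ}

theorem isIrreducible_of_samePattern (hA : A.IsIrreducible) (h : SamePattern B A)
    (hB : ∀ i j, 0 ≤ B i j) : B.IsIrreducible := by
  have hquiver : B.toQuiver = A.toQuiver := by
    simp only [Matrix.toQuiver, (h _ _).2]
  exact ⟨hB, hquiver ▸ hA.connected⟩

theorem forall_of_isIrreducible (hA : A.IsIrreducible) {P : Fin n → Prop}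
    (hstep : ∀ i j, P i → 0 < A i j → P j) {i : Fin n} (hi : P i) (j : Fin n) : P j := by
  let := A.toQuiver
  obtain ⟨path, -⟩ := hA.connected i j
  induction path with
  | nil => exact hi
  | cons _ e ih => exact hstep _ _ ih e.down

open scoped Matrix.Norms.Operator in
theorem linfty_opNorm_map_ofReal_le_one (hB : B ∈ Matrix.rowStochastic ℝ (Fin n)) :
    ‖B.map Complex.ofReal‖ ≤ 1 := by
  rw [Matrix.linfty_opNorm_def, ← NNReal.coe_one, NNReal.coe_le_coe]
  refine Finset.sup_le fun i _ => NNReal.coe_le_coe.1 ?_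
  rw [NNReal.coe_sum, NNReal.coe_one, ← Matrix.sum_row_of_mem_rowStochastic hB i]
  exact Finset.sum_le_sum fun j _ => by simp [abs_of_nonneg (hB.1 i j)]

open scoped Matrix.Norms.Operator in
theorem isDominantEigenvalue_one [Nonempty (Fin n)] (hB : B ∈ Matrix.rowStochastic ℝ (Fin n)) :
    IsDominantEigenvalue B 1 := by
  refine ⟨?_, fun μ hμ =>
    (spectrum.norm_le_norm_of_mem hμ).trans (linfty_opNorm_map_ofReal_le_one hB)⟩
  rw [← Matrix.spectrum_toLin', ← Module.End.hasEigenvalue_iff_mem_spectrum]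
  refine Module.End.hasEigenvalue_of_hasEigenvector (x := fun _ => (1 : ℂ))
    ⟨Module.End.mem_eigenspace_iff.2 (funext fun i => ?_), ?_⟩
  · simpa [Matrix.mulVec, dotProduct] using
      congrArg Complex.ofReal (Matrix.sum_row_of_mem_rowStochastic hB i)
  · exact Function.ne_iff.2 ⟨Classical.arbitrary _, one_ne_zero⟩

theorem isLeftDominantEigenvector_of_donorFlow_eq_zero (hirr : B.IsIrreducible)
    (hB : B ∈ Matrix.rowStochastic ℝ (Fin n)) (hw : w ∈ intSimplex n) (h : donorFlow B w = 0) :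
    IsLeftDominantEigenvector B w := by
  have := nonempty_of_mem_intSimplex hw
  rw [donorFlow_eq_vecMul_sub, sub_eq_zero] at h
  exact ⟨hirr, hB, hw, 1, isDominantEigenvalue_one hB, by rw [h, one_smul]⟩

/-- The convex potential `∑ᵢ wᵢ log (A eˣ)ᵢ - wᵀx` of the tilts of `A`: its gradient at `x` is
`expAppraisal A xᵀ w - w`, so its critical points are the tilts for which `w` is stationary. -/
noncomputable def freeEnergy (A : Matrix (Fin n) (Fin n) ℝ) (w x : Fin n → ℝ) : ℝ :=
  ∑ i, w i * Real.log ((A *ᵥ (Real.exp ∘ x)) i) - w ⬝ᵥ x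

theorem hasDerivWithinAt_log_mulVec_exp (hA : A ∈ Matrix.rowStochastic ℝ (Fin n))
    {y : ℝ → Fin n → ℝ} {q : Fin n → ℝ} {D : Set ℝ} {t : ℝ} (hy : HasDerivWithinAt y q D t)
    (i : Fin n) :
    HasDerivWithinAt (fun s => Real.log ((A *ᵥ (Real.exp ∘ y s)) i))
      ((expAppraisal A (y t) *ᵥ q) i) D t := by
  have hZ := (mulVec_exp_pos hA (y t) i).ne'
  exact ((hasDerivWithinAt_mulVec_exp hA hy i).log hZ).congr_deriv (mul_div_cancel_left₀ _ hZ)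

theorem hasDerivWithinAt_freeEnergy (hA : A ∈ Matrix.rowStochastic ℝ (Fin n)) (w : Fin n → ℝ)
    {y : ℝ → Fin n → ℝ} {q : Fin n → ℝ} {D : Set ℝ} {t : ℝ} (hy : HasDerivWithinAt y q D t) :
    HasDerivWithinAt (fun s => freeEnergy A w (y s)) (donorFlow (expAppraisal A (y t)) w ⬝ᵥ q)
      D t := by
  rw [donorFlow_dotProduct]
  exact HasDerivWithinAt.fun_sub
    (HasDerivWithinAt.fun_sum fun i _ => (hasDerivWithinAt_log_mulVec_exp hA hy i).const_mul (w i))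
    (HasDerivWithinAt.fun_sum fun i _ => (hasDerivWithinAt_pi.1 hy i).const_mul (w i))

theorem log_add_le_log_mulVec_exp (hA : ∀ i j, 0 ≤ A i j)
    {i j : Fin n} (hij : 0 < A i j) (x : Fin n → ℝ) :
    Real.log (A i j) + x j ≤ Real.log ((A *ᵥ (Real.exp ∘ x)) i) := by
  rw [← Real.log_exp (x j), ← Real.log_mul hij.ne' (Real.exp_pos _).ne']
  exact Real.log_le_log (mul_pos hij (Real.exp_pos _))
    (Finset.single_le_sum (f := fun k => A i k * Real.exp (x k))
      (fun k _ => mul_nonneg (hA i k) (Real.exp_pos _).le) (Finset.mem_univ j))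

theorem mulVec_le_log_mulVec_exp (hA : A ∈ Matrix.rowStochastic ℝ (Fin n)) (x : Fin n → ℝ)
    (i : Fin n) : (A *ᵥ x) i ≤ Real.log ((A *ᵥ (Real.exp ∘ x)) i) := by
  rw [Real.le_log_iff_exp_le (mulVec_exp_pos hA x i)]
  simpa [Matrix.mulVec, dotProduct] using convexOn_exp.map_sum_le (t := Finset.univ) (p := x)
    (fun j _ => hA.1 i j) (Matrix.sum_row_of_mem_rowStochastic hA i) (fun _ _ => Set.mem_univ _)

theorem eq_mulVec_of_mulVec_eq_log (hA : A ∈ Matrix.rowStochastic ℝ (Fin n)) {i j : Fin n}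
    (h : (A *ᵥ x) i = Real.log ((A *ᵥ (Real.exp ∘ x)) i)) (hij : 0 < A i j) :
    x j = (A *ᵥ x) i := by
  have hexp : Real.exp ((A *ᵥ x) i) = (A *ᵥ (Real.exp ∘ x)) i := by
    rw [h, Real.exp_log (mulVec_exp_pos hA x i)]
  exact (strictConvexOn_exp.map_sum_eq_iff' (t := Finset.univ) (p := x) (fun j _ => hA.1 i j)
    (Matrix.sum_row_of_mem_rowStochastic hA i) (fun _ _ => Set.mem_univ _)).1 hexp j
      (Finset.mem_univ j) hij.ne'

theorem freeEnergy_eq_sum_of_donorFlow_eq_zero (h : donorFlow A w = 0) (x : Fin n → ℝ) :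
    freeEnergy A w x = ∑ i, w i * (Real.log ((A *ᵥ (Real.exp ∘ x)) i) - (A *ᵥ x) i) := by
  have hstat : w ⬝ᵥ A *ᵥ x = w ⬝ᵥ x := by
    rw [← sub_eq_zero, ← donorFlow_dotProduct, h, zero_dotProduct]
  simp only [freeEnergy, mul_sub, Finset.sum_sub_distrib]
  rw [← hstat, dotProduct]

theorem freeEnergy_nonneg (hA : A ∈ Matrix.rowStochastic ℝ (Fin n)) (hw : 0 ≤ w)
    (h : donorFlow A w = 0) (x : Fin n → ℝ) : 0 ≤ freeEnergy A w x := by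
  rw [freeEnergy_eq_sum_of_donorFlow_eq_zero h]
  exact Finset.sum_nonneg fun i _ =>
    mul_nonneg (hw i) (sub_nonneg.2 (mulVec_le_log_mulVec_exp hA x i))

theorem eq_mulVec_of_freeEnergy_eq_zero (hA : A ∈ Matrix.rowStochastic ℝ (Fin n))
    (hw : ∀ i, 0 < w i) (h : donorFlow A w = 0) (hx : freeEnergy A w x = 0) {i j : Fin n}
    (hij : 0 < A i j) : x j = (A *ᵥ x) i := by
  rw [freeEnergy_eq_sum_of_donorFlow_eq_zero h, Finset.sum_eq_zero_iff_of_nonneg fun i _ =>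
    mul_nonneg (hw i).le (sub_nonneg.2 (mulVec_le_log_mulVec_exp hA x i))] at hx
  have hlog := (mul_eq_zero.1 (hx i (Finset.mem_univ i))).resolve_left (hw i).ne'
  exact eq_mulVec_of_mulVec_eq_log hA (sub_eq_zero.1 hlog).symm hij

theorem freeEnergy_expAppraisal_neg (hA : A ∈ Matrix.rowStochastic ℝ (Fin n))
    (w x : Fin n → ℝ) : freeEnergy (expAppraisal A x) w (-x) = -freeEnergy A w x := by
  have hZ : ∀ i, (expAppraisal A x *ᵥ (Real.exp ∘ (-x))) i = ((A *ᵥ (Real.exp ∘ x)) i)⁻¹ :=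
    fun i => by
      have hone : (Real.exp ∘ x) * (Real.exp ∘ (-x)) = 1 := funext fun j => by
        simp [Real.exp_neg, (Real.exp_pos _).ne']
      rw [expAppraisal, reducedAppraisal_mulVec, hone, Matrix.one_vecMul_of_mem_rowStochastic hA,
        Pi.one_apply, one_div]
  simp only [freeEnergy, hZ, Real.log_inv, mul_neg, Finset.sum_neg_distrib, dotProduct_neg]
  ring

theorem expAppraisal_eq_self_of_donorFlow_eq_zero (hA : A ∈ Matrix.rowStochastic ℝ (Fin n))
    (hirr : A.IsIrreducible) (hdiag : ∀ i, 0 < A i i) (hw : ∀ i, 0 < w i)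
    (h : donorFlow A w = 0) (hx : donorFlow (expAppraisal A x) w = 0) : expAppraisal A x = A := by
  have hle : 0 ≤ -freeEnergy A w x := freeEnergy_expAppraisal_neg hA w x ▸
    freeEnergy_nonneg (expAppraisal_mem_rowStochastic hA x) (fun i => (hw i).le) hx (-x)
  have hzero : freeEnergy A w x = 0 :=
    (neg_nonneg.1 hle).antisymm (freeEnergy_nonneg hA (fun i => (hw i).le) h x)
  have hedge : ∀ i j, 0 < A i j → x j = x i := fun i j hij =>
    (eq_mulVec_of_freeEnergy_eq_zero hA hw h hzero hij).trans
      (eq_mulVec_of_freeEnergy_eq_zero hA hw h hzero (hdiag i)).symm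
  have hconst : ∀ i j, x i = x j := fun i j =>
    forall_of_isIrreducible hirr (P := fun j => x i = x j)
      (fun k l hk hkl => hk.trans (hedge k l hkl).symm) rfl j
  ext i j
  have hx_eq : x = fun k => (0 : Fin n → ℝ) k - -x i := funext fun k => by
    rw [Pi.zero_apply, zero_sub, neg_neg, hconst k i]
  rw [hx_eq, expAppraisal_sub_const, expAppraisal_zero hA]

theorem expAppraisal_eq_of_donorFlow_eq_zero (hA : A ∈ Matrix.rowStochastic ℝ (Fin n))
    (hirr : A.IsIrreducible) (hdiag : ∀ i, 0 < A i i) (hw : ∀ i, 0 < w i) {x' : Fin n → ℝ}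
    (hx : donorFlow (expAppraisal A x) w = 0) (hx' : donorFlow (expAppraisal A x') w = 0) :
    expAppraisal A x' = expAppraisal A x := by
  have hcomp : expAppraisal (expAppraisal A x) (x' - x) = expAppraisal A x' := by
    rw [expAppraisal_expAppraisal hA, add_sub_cancel]
  have hS := expAppraisal_mem_rowStochastic hA x
  have hpat := samePattern_expAppraisal hA x
  rw [← hcomp]
  exact expAppraisal_eq_self_of_donorFlow_eq_zero hS (isIrreducible_of_samePattern hirr hpat hS.1)
    (fun i => (hpat i i).2.2 (hdiag i)) hw hx (hcomp ▸ hx')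

end Irreducible

/-! ### Convergence when the cumulative performances stay bounded above -/

section Antitone

variable {f : ℝ → ℝ} {a b x₀ : ℝ}

theorem sub_mul_sub_nonneg_of_antitoneOn {s : Set ℝ} (hf : AntitoneOn f s) {x : ℝ} (hx₀ : x₀ ∈ s)
    (hx : x ∈ s) : 0 ≤ (x₀ - x) * (f x - f x₀) := by
  rcases le_total x x₀ with h | h
  · exact mul_nonneg (sub_nonneg.2 h) (sub_nonneg.2 (hf hx hx₀ h))
  · exact mul_nonneg_of_nonpos_of_nonpos (sub_nonpos.2 h) (sub_nonpos.2 (hf hx₀ hx h))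

theorem exists_pos_forall_le_sub_of_add_le {s : Set ℝ} [s.OrdConnected] (hf : StrictAntiOn f s)
    (hx₀ : x₀ ∈ s) {δ : ℝ} (hδ : 0 < δ) :
    ∃ m > 0, ∀ x ∈ s, x₀ + δ ≤ x → m ≤ f x₀ - f x := by
  by_cases hmem : x₀ + δ ∈ s
  · exact ⟨f x₀ - f (x₀ + δ), sub_pos.2 (hf hx₀ hmem (lt_add_of_pos_right _ hδ)),
      fun x hx hxδ => sub_le_sub_left (hf.antitoneOn hmem hx hxδ) _⟩
  · exact ⟨1, one_pos, fun x hx hxδ =>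
      absurd (Set.OrdConnected.out ‹_› hx₀ hx ⟨le_add_of_nonneg_right hδ.le, hxδ⟩) hmem⟩

theorem exists_pos_forall_le_sub_of_le_sub {s : Set ℝ} [s.OrdConnected] (hf : StrictAntiOn f s)
    (hx₀ : x₀ ∈ s) {δ : ℝ} (hδ : 0 < δ) :
    ∃ m > 0, ∀ x ∈ s, x ≤ x₀ - δ → m ≤ f x - f x₀ := by
  by_cases hmem : x₀ - δ ∈ s
  · exact ⟨f (x₀ - δ) - f x₀, sub_pos.2 (hf hmem hx₀ (sub_lt_self _ hδ)),
      fun x hx hxδ => sub_le_sub_right (hf.antitoneOn hx hmem hxδ) _⟩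
  · exact ⟨1, one_pos, fun x hx hxδ =>
      absurd (Set.OrdConnected.out ‹_› hx hx₀ ⟨hxδ, sub_le_self _ hδ.le⟩) hmem⟩

theorem exists_pos_forall_le_sub_mul_sub_of_le_dist {s : Set ℝ} [s.OrdConnected]
    (hf : StrictAntiOn f s) (hx₀ : x₀ ∈ s) {δ : ℝ} (hδ : 0 < δ) :
    ∃ m > 0, ∀ x ∈ s, δ ≤ dist x x₀ → m ≤ (x₀ - x) * (f x - f x₀) := by
  obtain ⟨m₁, hm₁, hright⟩ := exists_pos_forall_le_sub_of_add_le hf hx₀ hδ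
  obtain ⟨m₂, hm₂, hleft⟩ := exists_pos_forall_le_sub_of_le_sub hf hx₀ hδ
  refine ⟨δ * min m₁ m₂, mul_pos hδ (lt_min hm₁ hm₂), fun x hx hxδ => ?_⟩
  rw [Real.dist_eq, le_abs'] at hxδ
  rcases hxδ with h | h
  · exact mul_le_mul (by linarith) ((min_le_right _ _).trans (hleft x hx (by linarith)))
      (lt_min hm₁ hm₂).le (by linarith)
  · rw [← neg_mul_neg (x₀ - x), neg_sub, neg_sub]
    exact mul_le_mul h ((min_le_left _ _).trans (hright x hx (by linarith)))
      (lt_min hm₁ hm₂).le (by linarith)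

theorem exists_bounded_hasDerivWithinAt_Ioc (hcont : ContinuousOn f (Set.Ioc a b))
    (hint : MeasureTheory.IntegrableOn f (Set.Ioc a b)) :
    ∃ (F : ℝ → ℝ) (B : ℝ), ∀ x ∈ Set.Ioc a b,
      |F x| ≤ B ∧ HasDerivWithinAt F (f x) (Set.Ioc a b) x := by
  rcases le_or_gt b a with hba | hab
  · exact ⟨0, 0, fun x hx => absurd (hx.1.trans_le hx.2) hba.not_gt⟩
  set g : ℝ → ℝ := fun x => f (min x b) with hg
  have hfg : Set.EqOn f g (Set.Ioc a b) := fun x hx => by simp [hg, min_eq_left hx.2]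
  have hg_int : MeasureTheory.IntegrableOn g (Set.Ioc a b) := hint.congr_fun hfg measurableSet_Ioc
  have hg_cont : ContinuousOn g (Set.Ioi a) :=
    hcont.comp (by fun_prop) fun x hx => ⟨lt_min hx hab, min_le_right _ _⟩
  refine ⟨fun x => ∫ s in a..x, g s, ∫ s in Set.Ioc a b, ‖g s‖, fun x hx => ?_⟩
  have hsub : Set.Ioc a x ⊆ Set.Ioc a b := Set.Ioc_subset_Ioc_right hx.2
  constructor
  · beta_reduce
    rw [intervalIntegral.integral_of_le hx.1.le]
    exact (MeasureTheory.norm_integral_le_integral_norm _).trans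
      (MeasureTheory.setIntegral_mono_set hg_int.norm
        (Eventually.of_forall fun s => norm_nonneg _) hsub.eventuallyLE)
  · rw [hfg hx]
    exact (intervalIntegral.integral_hasDerivAt_right
      ((intervalIntegrable_iff_integrableOn_Ioc_of_le hx.1.le).2 (hg_int.mono_set hsub))
      (hg_cont.stronglyMeasurableAtFilter isOpen_Ioi x hx.1)
      (hg_cont.continuousAt (Ioi_mem_nhds hx.1))).hasDerivWithinAt

theorem uniformContinuousOn_of_forall_hasDerivWithinAt {E : Type*} [NormedAddCommGroup E]
    [NormedSpace ℝ E] {D : Set ℝ} (hD : Convex ℝ D) {f f' : ℝ → E}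
    (hf : ∀ x ∈ D, HasDerivWithinAt f (f' x) D x) {C : ℝ} (hC : ∀ x ∈ D, ‖f' x‖ ≤ C) :
    UniformContinuousOn f D :=
  (hD.lipschitzOnWith_of_nnnorm_hasDerivWithin_le (C := C.toNNReal) hf fun x hx =>
    NNReal.coe_le_coe.1 ((hC x hx).trans (Real.le_coe_toNNReal C))).uniformContinuousOn

end Antitone

theorem sub_div_le_of_le_dotProduct {ι : Type*} [Fintype ι] {v x : ι → ℝ} (hv : ∀ i, 0 < v i)
    (hv₁ : ∑ i, v i = 1) {c C : ℝ} (hC : ∀ i, x i ≤ C) (hc : c ≤ v ⬝ᵥ x) (i : ι) :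
    C - (C - c) / v i ≤ x i := by
  have hsum : ∑ j, v j * (C - x j) = C - v ⬝ᵥ x := by
    simp only [mul_sub, Finset.sum_sub_distrib, ← Finset.sum_mul, hv₁, one_mul, dotProduct]
  have hsingle := Finset.single_le_sum (f := fun j => v j * (C - x j))
    (fun j _ => mul_nonneg (hv j).le (sub_nonneg.2 (hC j))) (Finset.mem_univ i)
  rw [sub_le_comm, le_div_iff₀ (hv i), mul_comm]
  linarith

theorem exists_tendsto_expAppraisal {ι : Type*} {l : Filter ι} [l.NeBot] {n : ℕ}
    {A : Matrix (Fin n) (Fin n) ℝ} (hA : A ∈ Matrix.rowStochastic ℝ (Fin n))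
    (hirr : A.IsIrreducible) (hdiag : ∀ i, 0 < A i i) {K : Set (Fin n → ℝ)} (hK : IsCompact K)
    {y w : ι → Fin n → ℝ} {c : ι → ℝ} (hy : ∀ᶠ t in l, (fun i => y t i - c t) ∈ K)
    {w₁ : Fin n → ℝ} (hw₁ : ∀ i, 0 < w₁ i) (hw : Tendsto w l (𝓝 w₁))
    (hflow : Tendsto (fun t => donorFlow (expAppraisal A (y t)) (w t)) l (𝓝 0)) :
    ∃ x, Tendsto (fun t => expAppraisal A (y t)) l (𝓝 (expAppraisal A x)) ∧
      donorFlow (expAppraisal A x) w₁ = 0 := by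
  have hmem : ∀ᶠ t in l, expAppraisal A (y t) ∈ expAppraisal A '' K := hy.mono fun t ht =>
    ⟨_, ht, expAppraisal_sub_const A (y t) (c t)⟩
  have hstat : ∀ S, MapClusterPt S l (fun t => expAppraisal A (y t)) → donorFlow S w₁ = 0 :=
    fun S hS => by
      obtain ⟨u, hu, hSu⟩ := mapClusterPt_iff_ultrafilter.1 hS
      have hcont : Continuous fun z : Matrix (Fin n) (Fin n) ℝ × (Fin n → ℝ) =>
          donorFlow z.1 z.2 := by
        simp only [donorFlow_eq_vecMul_sub]
        exact (continuous_snd.matrix_vecMul continuous_fst).sub continuous_snd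
      exact tendsto_nhds_unique ((hcont.tendsto (S, w₁)).comp (hSu.prodMk_nhds (hw.mono_left hu)))
        (hflow.mono_left hu)
  have hcompact := hK.image (continuous_expAppraisal hA)
  obtain ⟨_, ⟨x, -, rfl⟩, hx⟩ := hcompact.exists_mapClusterPt_of_frequently hmem.frequently
  refine ⟨x, hcompact.tendsto_nhds_of_unique_mapClusterPt hmem ?_, hstat _ hx⟩
  rintro _ ⟨x', -, rfl⟩ hx'
  exact expAppraisal_eq_of_donorFlow_eq_zero hA hirr hdiag hw₁ (hstat _ hx) (hstat _ hx')

section Convergence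

variable {n : ℕ} {p : Fin n → ℝ → ℝ} {A₀ : Matrix (Fin n) (Fin n) ℝ} {w₀ : Fin n → ℝ}
  {y w : ℝ → Fin n → ℝ} {pstar : ℝ} {wopt : Fin n → ℝ} {z Θ : ℝ → ℝ}

theorem IsOptimalPair.sub_dotProduct_perf (hq : IsOptimalPair p (pstar, wopt)) {x : Fin n → ℝ}
    (hx : x ∈ intSimplex n) :
    (wopt - x) ⬝ᵥ perf p x = ∑ i, (wopt i - x i) * (p i (x i) - p i (wopt i)) := by
  have hconst : ∀ i, p i (wopt i) = pstar := congrFun hq.2.2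
  have hzero : ∑ i, (wopt i - x i) = 0 := by
    rw [Finset.sum_sub_distrib, hq.2.1.2, hx.2, sub_self]
  simp only [hconst, mul_sub _ _ pstar, Finset.sum_sub_distrib, ← Finset.sum_mul _ _ pstar, hzero]
  rw [zero_mul, sub_zero]
  rfl

theorem IsOptimalPair.sub_dotProduct_perf_nonneg (hanti : ∀ i, StrictAntiOn (p i) (Set.Ioc 0 1))
    (hq : IsOptimalPair p (pstar, wopt)) {x : Fin n → ℝ} (hx : x ∈ intSimplex n) :
    0 ≤ (wopt - x) ⬝ᵥ perf p x := by
  rw [hq.sub_dotProduct_perf hx]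
  exact Finset.sum_nonneg fun i _ => sub_mul_sub_nonneg_of_antitoneOn (hanti i).antitoneOn
    (mem_Ioc_of_mem_intSimplex hq.2.1 i) (mem_Ioc_of_mem_intSimplex hx i)

theorem IsOptimalPair.exists_pos_forall_le_sub_dotProduct_perf
    (hanti : ∀ i, StrictAntiOn (p i) (Set.Ioc 0 1)) (hq : IsOptimalPair p (pstar, wopt))
    (i : Fin n) {δ : ℝ} (hδ : 0 < δ) :
    ∃ m > 0, ∀ x ∈ intSimplex n, δ ≤ dist (x i) (wopt i) → m ≤ (wopt - x) ⬝ᵥ perf p x := by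
  have hopt := mem_Ioc_of_mem_intSimplex hq.2.1
  obtain ⟨m, hm, hgap⟩ := exists_pos_forall_le_sub_mul_sub_of_le_dist (hanti i) (hopt i) hδ
  refine ⟨m, hm, fun x hx hxδ => ?_⟩
  have hmem := mem_Ioc_of_mem_intSimplex hx
  rw [hq.sub_dotProduct_perf hx]
  exact (hgap _ (hmem i) hxδ).trans (Finset.single_le_sum
    (f := fun i => (wopt i - x i) * (p i (x i) - p i (wopt i)))
    (fun j _ => sub_mul_sub_nonneg_of_antitoneOn (hanti j).antitoneOn (hopt j) (hmem j))
    (Finset.mem_univ i))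

namespace IsCumulativeTrajectory

theorem hasDerivWithinAt_dotProduct_sub (h : IsCumulativeTrajectory p A₀ w₀ y w)
    (hz : ∀ t ∈ Set.Ici 0, HasDerivWithinAt z (w t ⬝ᵥ perf p (w t)) (Set.Ici 0) t)
    (v : Fin n → ℝ) {t : ℝ} (ht : t ∈ Set.Ici 0) :
    HasDerivWithinAt (fun t => v ⬝ᵥ y t - z t) ((v - w t) ⬝ᵥ perf p (w t)) (Set.Ici 0) t := by
  rw [sub_dotProduct]
  exact (HasDerivWithinAt.fun_sum fun i _ =>
    (hasDerivWithinAt_pi.1 (h.deriv_y t ht) i).const_mul (v i)).fun_sub (hz t ht)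

theorem monotoneOn_dotProduct_sub (hanti : ∀ i, StrictAntiOn (p i) (Set.Ioc 0 1))
    (hq : IsOptimalPair p (pstar, wopt)) (h : IsCumulativeTrajectory p A₀ w₀ y w)
    (hz : ∀ t ∈ Set.Ici 0, HasDerivWithinAt z (w t ⬝ᵥ perf p (w t)) (Set.Ici 0) t) :
    MonotoneOn (fun t => wopt ⬝ᵥ y t - z t) (Set.Ici 0) :=
  monotoneOn_of_forall_hasDerivWithinAt_nonneg (convex_Ici 0)
    (fun _ => h.hasDerivWithinAt_dotProduct_sub hz wopt)
    fun t ht => hq.sub_dotProduct_perf_nonneg hanti (h.mem_w t ht)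

theorem uniformContinuousOn_w (hA : A₀ ∈ Matrix.rowStochastic ℝ (Fin n))
    (h : IsCumulativeTrajectory p A₀ w₀ y w) : UniformContinuousOn w (Set.Ici 0) :=
  uniformContinuousOn_of_forall_hasDerivWithinAt (convex_Ici 0) h.deriv_w fun t ht =>
    norm_donorFlow_le (expAppraisal_mem_rowStochastic hA _)
      (mem_Icc_of_mem_intSimplex (h.mem_w t ht))

theorem tendsto_w (hanti : ∀ i, StrictAntiOn (p i) (Set.Ioc 0 1))
    (hA : A₀ ∈ Matrix.rowStochastic ℝ (Fin n)) (hq : IsOptimalPair p (pstar, wopt))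
    (h : IsCumulativeTrajectory p A₀ w₀ y w)
    (hz : ∀ t ∈ Set.Ici 0, HasDerivWithinAt z (w t ⬝ᵥ perf p (w t)) (Set.Ici 0) t)
    {C : ℝ} (hC : ∀ t ∈ Set.Ici 0, wopt ⬝ᵥ y t - z t ≤ C) : Tendsto w atTop (𝓝 wopt) := by
  obtain ⟨l, hl⟩ :=
    exists_tendsto_atTop_of_monotoneOn_Ici (h.monotoneOn_dotProduct_sub hanti hq hz) hC
  refine tendsto_pi_nhds.2 fun i => Metric.tendsto_nhds.2 fun δ hδ => ?_
  have hdist : UniformContinuous fun x : Fin n → ℝ => dist (x i) (wopt i) :=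
    (Pi.uniformContinuous_proj _ i).dist uniformContinuous_const
  refine eventually_lt_of_uniformContinuousOn (a := 0)
    (fun _ => h.hasDerivWithinAt_dotProduct_sub hz wopt) hl
    (hdist.comp_uniformContinuousOn (h.uniformContinuousOn_w hA)) (fun δ hδ => ?_) hδ
  obtain ⟨m, hm, hgap⟩ := hq.exists_pos_forall_le_sub_dotProduct_perf hanti i hδ
  exact ⟨m, hm, fun t ht => hgap _ (h.mem_w t ht)⟩

theorem exists_forall_norm_perf_le (hcont : ∀ i, ContinuousOn (p i) (Set.Ioc 0 1))
    (hopt : wopt ∈ intSimplex n) (h : IsCumulativeTrajectory p A₀ w₀ y w)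
    (hw : Tendsto w atTop (𝓝 wopt)) :
    ∃ T ≥ 0, ∃ M, ∀ t ∈ Set.Ici T, ‖perf p (w t)‖ ≤ M := by
  have hperf : Tendsto (fun t => perf p (w t)) atTop (𝓝 (perf p wopt)) :=
    tendsto_pi_nhds.2 fun i => (hcont i _ (mem_Ioc_of_mem_intSimplex hopt i)).tendsto.comp <|
      tendsto_nhdsWithin_iff.2 ⟨tendsto_pi_nhds.1 hw i, by
        filter_upwards [eventually_ge_atTop 0] with t ht using
          mem_Ioc_of_mem_intSimplex (h.mem_w t ht) i⟩
  obtain ⟨T, hT⟩ := eventually_atTop.1 <| (eventually_ge_atTop 0).and <|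
    hperf.norm.eventually (gt_mem_nhds (lt_add_one _))
  exact ⟨T, (hT T le_rfl).1, _, fun t ht => (hT t ht).2.le⟩

theorem tendsto_donorFlow (hcont : ∀ i, ContinuousOn (p i) (Set.Ioc 0 1))
    (hA : A₀ ∈ Matrix.rowStochastic ℝ (Fin n)) (hopt : wopt ∈ intSimplex n)
    (h : IsCumulativeTrajectory p A₀ w₀ y w) (hw : Tendsto w atTop (𝓝 wopt)) :
    Tendsto (fun t => donorFlow (expAppraisal A₀ (y t)) (w t)) atTop (𝓝 0) := by
  obtain ⟨T, hT, M, hM⟩ := h.exists_forall_norm_perf_le hcont hopt hw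
  have hsub : Set.Ici T ⊆ Set.Ici 0 := Set.Ici_subset_Ici.2 hT
  have hyw : UniformContinuousOn (fun t => (y t, w t)) (Set.Ici T) :=
    uniformContinuousOn_of_forall_hasDerivWithinAt (convex_Ici T)
      (fun t ht => ((h.deriv_y t (hsub ht)).prodMk (h.deriv_w t (hsub ht))).mono hsub)
      fun t ht => max_le_max (hM t ht) (norm_donorFlow_le (expAppraisal_mem_rowStochastic hA _)
        (mem_Icc_of_mem_intSimplex (h.mem_w t (hsub ht))))
  have hflow : UniformContinuousOn (fun t => donorFlow (expAppraisal A₀ (y t)) (w t))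
      (Set.Ici T) :=
    (lipschitzOnWith_donorFlow_expAppraisal hA).uniformContinuousOn.comp hyw fun t ht =>
      mem_Icc_of_mem_intSimplex (h.mem_w t (hsub ht))
  exact tendsto_pi_nhds.2 fun i => tendsto_zero_of_uniformContinuousOn_deriv
    (fun t ht => (hasDerivWithinAt_pi.1 (h.deriv_w t (hsub ht)) i).mono hsub)
    (tendsto_pi_nhds.1 hw i) ((Pi.uniformContinuous_proj _ i).comp_uniformContinuousOn hflow)

theorem exists_tendsto_of_sub_le (hcont : ∀ i, ContinuousOn (p i) (Set.Ioc 0 1))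
    (hanti : ∀ i, StrictAntiOn (p i) (Set.Ioc 0 1))
    (hA : A₀ ∈ Matrix.rowStochastic ℝ (Fin n)) (hirr : A₀.IsIrreducible)
    (hdiag : ∀ i, 0 < A₀ i i) (hq : IsOptimalPair p (pstar, wopt))
    (h : IsCumulativeTrajectory p A₀ w₀ y w)
    (hz : ∀ t ∈ Set.Ici 0, HasDerivWithinAt z (w t ⬝ᵥ perf p (w t)) (Set.Ici 0) t)
    {C : ℝ} (hC : ∀ t ∈ Set.Ici 0, ∀ i, y t i - z t ≤ C) :
    ∃ x, Tendsto (fun t => (expAppraisal A₀ (y t), w t)) atTop (𝓝 (expAppraisal A₀ x, wopt)) ∧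
      donorFlow (expAppraisal A₀ x) wopt = 0 := by
  have hopt := hq.2.1
  have hmean : ∀ t, wopt ⬝ᵥ (fun i => y t i - z t) = wopt ⬝ᵥ y t - z t := fun t => by
    simp only [dotProduct, mul_sub, Finset.sum_sub_distrib, ← Finset.sum_mul, hopt.2, one_mul]
  have hUC : ∀ t ∈ Set.Ici 0, wopt ⬝ᵥ y t - z t ≤ C := fun t ht => by
    rw [← hmean, ← one_mul C, ← hopt.2, Finset.sum_mul]
    exact Finset.sum_le_sum fun i _ => mul_le_mul_of_nonneg_left (hC t ht i) (hopt.1 i).le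
  have hUmono := h.monotoneOn_dotProduct_sub hanti hq hz
  have hw := h.tendsto_w hanti hA hq hz hUC
  have hbox : ∀ᶠ t in atTop, (fun i => y t i - z t) ∈
      Set.Icc (fun i => C - (C - (wopt ⬝ᵥ y 0 - z 0)) / wopt i) fun _ => C := by
    filter_upwards [eventually_ge_atTop 0] with t ht
    exact ⟨sub_div_le_of_le_dotProduct hopt.1 hopt.2 (hC t ht)
      ((hUmono Set.self_mem_Ici ht ht).trans_eq (hmean t).symm), hC t ht⟩
  obtain ⟨x, hlim, hstat⟩ := exists_tendsto_expAppraisal hA hirr hdiag isCompact_Icc hbox hopt.1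
    hw (h.tendsto_donorFlow hcont hA hopt hw)
  exact ⟨x, hlim.prodMk_nhds hw, hstat⟩

theorem exists_forall_abs_sub_le (hcont : ∀ i, ContinuousOn (p i) (Set.Ioc 0 1))
    (hint : ∀ i, MeasureTheory.IntegrableOn (p i) (Set.Ioc 0 1))
    (h : IsCumulativeTrajectory p A₀ w₀ y w)
    (hz : ∀ t ∈ Set.Ici 0, HasDerivWithinAt z (w t ⬝ᵥ perf p (w t)) (Set.Ici 0) t)
    (hΘ : ∀ t ∈ Set.Ici 0, HasDerivWithinAt Θ
      (w t ⬝ᵥ expAppraisal A₀ (y t) *ᵥ perf p (w t)) (Set.Ici 0) t) :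
    ∃ B, ∀ t ∈ Set.Ici 0, |Θ t - z t| ≤ B := by
  choose F B hF using fun i => exists_bounded_hasDerivWithinAt_Ioc (hcont i) (hint i)
  have hmem : ∀ t ∈ Set.Ici 0, ∀ i, w t i ∈ Set.Ioc (0 : ℝ) 1 := fun t ht =>
    mem_Ioc_of_mem_intSimplex (h.mem_w t ht)
  have hconst : ∀ t ∈ Set.Ici 0, HasDerivWithinAt (fun t => ∑ i, F i (w t i) - (Θ t - z t)) 0
      (Set.Ici 0) t := fun t ht => by
    refine ((HasDerivWithinAt.fun_sum (u := Finset.univ) fun i _ =>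
      (hF i _ (hmem t ht i)).2.comp t (hasDerivWithinAt_pi.1 (h.deriv_w t ht) i)
        fun s hs => hmem s hs i).fun_sub ((hΘ t ht).fun_sub (hz t ht))).congr_deriv ?_
    rw [← donorFlow_dotProduct, dotProduct_comm]
    exact sub_self _
  have hbdd : ∀ t ∈ Set.Ici 0, |∑ i, F i (w t i)| ≤ ∑ i, B i := fun t ht =>
    (Finset.abs_sum_le_sum_abs _ _).trans
      (Finset.sum_le_sum fun i _ => (hF i _ (hmem t ht i)).1)
  refine ⟨2 * ∑ i, B i + |Θ 0 - z 0|, fun t ht => ?_⟩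
  have heq : Θ t - z t = ∑ i, F i (w t i) - ∑ i, F i (w 0 i) + (Θ 0 - z 0) := by
    linarith [eqOn_const_of_forall_hasDerivWithinAt_zero (convex_Ici 0) hconst ht
      Set.self_mem_Ici]
  rw [heq]
  linarith [abs_add_le (∑ i, F i (w t i) - ∑ i, F i (w 0 i)) (Θ 0 - z 0),
    abs_sub (∑ i, F i (w t i)) (∑ i, F i (w 0 i)), hbdd t ht, hbdd 0 Set.self_mem_Ici]

theorem exists_tendsto_of_sub_mean_le (hcont : ∀ i, ContinuousOn (p i) (Set.Ioc 0 1))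
    (hanti : ∀ i, StrictAntiOn (p i) (Set.Ioc 0 1))
    (hint : ∀ i, MeasureTheory.IntegrableOn (p i) (Set.Ioc 0 1))
    (hA : A₀ ∈ Matrix.rowStochastic ℝ (Fin n)) (hirr : A₀.IsIrreducible)
    (hdiag : ∀ i, 0 < A₀ i i) (hq : IsOptimalPair p (pstar, wopt))
    (h : IsCumulativeTrajectory p A₀ w₀ y w)
    (hΘ : ∀ t ∈ Set.Ici 0, HasDerivWithinAt Θ
      (w t ⬝ᵥ expAppraisal A₀ (y t) *ᵥ perf p (w t)) (Set.Ici 0) t)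
    {C : ℝ} (hC : ∀ t ∈ Set.Ici 0, ∀ i, y t i - Θ t ≤ C) :
    ∃ x, Tendsto (fun t => (expAppraisal A₀ (y t), w t)) atTop (𝓝 (expAppraisal A₀ x, wopt)) ∧
      donorFlow (expAppraisal A₀ x) wopt = 0 := by
  obtain ⟨z, -, hz⟩ := h.exists_hasDerivWithinAt_dotProduct_perf hcont
  obtain ⟨B, hB⟩ := h.exists_forall_abs_sub_le hcont hint hz hΘ
  refine h.exists_tendsto_of_sub_le hcont hanti hA hirr hdiag hq hz (C := C + B) fun t ht i => ?_
  linarith [hC t ht i, (abs_le.1 (hB t ht)).2]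

end IsCumulativeTrajectory

end Convergence

/-! ### Rank-one initial appraisals -/

section RankOne

variable {n : ℕ} {p : Fin n → ℝ → ℝ} {A : Matrix (Fin n) (Fin n) ℝ} {w : Fin n → ℝ}

theorem mulVec_apply_eq_of_row_eq (hrow : ∀ i k, A i = A k) (q : Fin n → ℝ) (i k : Fin n) :
    (A *ᵥ q) i = (A *ᵥ q) k :=
  congrArg (· ⬝ᵥ q) (hrow i k)

theorem dotProduct_mulVec_of_row_eq (hrow : ∀ i k, A i = A k) (hw : ∑ i, w i = 1)
    (q : Fin n → ℝ) (k : Fin n) : w ⬝ᵥ A *ᵥ q = (A *ᵥ q) k := by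
  simp only [dotProduct, mulVec_apply_eq_of_row_eq hrow q _ k, ← Finset.sum_mul, hw, one_mul]

theorem expAppraisal_row_eq (hrow : ∀ i k, A i = A k) (x : Fin n → ℝ) (i k : Fin n) :
    expAppraisal A x i = expAppraisal A x k := by
  ext j
  rw [expAppraisal_apply, expAppraisal_apply, hrow i k, mulVec_apply_eq_of_row_eq hrow _ i k]

theorem eq_vecMulVec_of_donorFlow_eq_zero (hrow : ∀ i k, A i = A k) (hw : ∑ i, w i = 1)
    (h : donorFlow A w = 0) : A = Matrix.vecMulVec (fun _ => 1) w := by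
  rw [donorFlow_eq_vecMul_sub, sub_eq_zero] at h
  ext i j
  calc A i j = ∑ k, w k * A k j := by
        simp only [hrow _ i, ← Finset.sum_mul, hw, one_mul]
    _ = Matrix.vecMulVec (fun _ => 1) w i j := by
        rw [Matrix.vecMulVec_apply, one_mul]
        exact congrFun h j

theorem IsCumulativeTrajectory.log_mulVec_exp_eq (hA : A ∈ Matrix.rowStochastic ℝ (Fin n))
    (hrow : ∀ i k, A i = A k) {w₀ : Fin n → ℝ} {y w : ℝ → Fin n → ℝ} {Θ : ℝ → ℝ}
    (h : IsCumulativeTrajectory p A w₀ y w) (hΘ₀ : Θ 0 = 0)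
    (hΘ : ∀ t ∈ Set.Ici 0, HasDerivWithinAt Θ
      (w t ⬝ᵥ expAppraisal A (y t) *ᵥ perf p (w t)) (Set.Ici 0) t)
    {t : ℝ} (ht : t ∈ Set.Ici 0) (i : Fin n) :
    Real.log ((A *ᵥ (Real.exp ∘ y t)) i) = Θ t := by
  have hderiv : ∀ s ∈ Set.Ici 0, HasDerivWithinAt
      (fun s => Real.log ((A *ᵥ (Real.exp ∘ y s)) i) - Θ s) 0 (Set.Ici 0) s := fun s hs => by
    refine ((hasDerivWithinAt_log_mulVec_exp hA (h.deriv_y s hs) i).fun_sub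
      (hΘ s hs)).congr_deriv ?_
    rw [dotProduct_mulVec_of_row_eq (expAppraisal_row_eq hrow _) (h.mem_w s hs).2 _ i, sub_self]
  have hinit : (A *ᵥ (Real.exp ∘ y 0)) i = 1 := by
    simpa [h.init_y, Matrix.mulVec, dotProduct] using Matrix.sum_row_of_mem_rowStochastic hA i
  have hconst := eqOn_const_of_forall_hasDerivWithinAt_zero (convex_Ici 0) hderiv ht
    Set.self_mem_Ici
  rwa [hinit, hΘ₀, Real.log_one, sub_zero, sub_eq_zero] at hconst

theorem IsCumulativeTrajectory.tendsto_of_rank_one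
    (hcont : ∀ i, ContinuousOn (p i) (Set.Ioc 0 1))
    (hanti : ∀ i, StrictAntiOn (p i) (Set.Ioc 0 1))
    (hint : ∀ i, MeasureTheory.IntegrableOn (p i) (Set.Ioc 0 1))
    {a : Fin n → ℝ} (ha : a ∈ intSimplex n)
    (hA : Matrix.vecMulVec (fun _ => 1) a ∈ Matrix.rowStochastic ℝ (Fin n))
    (hirr : (Matrix.vecMulVec (fun _ => 1) a).IsIrreducible) {pstar : ℝ} {wopt : Fin n → ℝ}
    (hq : IsOptimalPair p (pstar, wopt)) {w₀ : Fin n → ℝ} {y w : ℝ → Fin n → ℝ}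
    (h : IsCumulativeTrajectory p (Matrix.vecMulVec (fun _ => 1) a) w₀ y w) :
    Tendsto (fun t => (expAppraisal (Matrix.vecMulVec (fun _ => 1) a) (y t), w t)) atTop
      (𝓝 (Matrix.vecMulVec (fun _ => 1) wopt, wopt)) := by
  set A : Matrix (Fin n) (Fin n) ℝ := Matrix.vecMulVec (fun _ => 1) a
  have hAa : ∀ i j, A i j = a j := fun _ _ => one_mul _
  have hrow : ∀ i k, A i = A k := fun i k => funext fun j => (hAa i j).trans (hAa k j).symm
  obtain ⟨Θ, hΘ₀, hΘ⟩ := h.exists_hasDerivWithinAt_dotProduct_mulVec_perf hcont hA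
  obtain ⟨ε, hε, hεa⟩ := exists_pos_forall_le_of_mem_intSimplex ha
  obtain ⟨x, hlim, hstat⟩ := h.exists_tendsto_of_sub_mean_le hcont hanti hint hA hirr
    (fun i => (hAa i i).symm ▸ ha.1 i) hq hΘ (C := -Real.log ε) fun t ht i => by
      have hle := log_add_le_log_mulVec_exp hA.1 ((hAa i i).symm ▸ ha.1 i) (y t)
      rw [h.log_mulVec_exp_eq hA hrow hΘ₀ hΘ ht, hAa] at hle
      linarith [Real.log_le_log hε.1 (hεa i)]
  rwa [eq_vecMulVec_of_donorFlow_eq_zero (expAppraisal_row_eq hrow x) hq.2.1.2 hstat] at hlim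

end RankOne

/-! ### Positive initial appraisals between two individuals -/

theorem exists_dotProduct_le_of_mem_intSimplex {n : ℕ} {w : Fin n → ℝ} (hw : w ∈ intSimplex n)
    (x : Fin n → ℝ) : ∃ i, w ⬝ᵥ x ≤ x i := by
  have := nonempty_of_mem_intSimplex hw
  obtain ⟨i, -, hi⟩ := Finset.exists_le_of_sum_le (s := Finset.univ)
    (f := fun i => w i * (w ⬝ᵥ x)) (g := fun i => w i * x i) Finset.univ_nonempty
    (by rw [← Finset.sum_mul, hw.2, one_mul, dotProduct])
  exact ⟨i, le_of_mul_le_mul_left hi (hw.1 i)⟩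

theorem exists_forall_add_le_freeEnergy {n : ℕ} {A : Matrix (Fin n) (Fin n) ℝ}
    (hpos : ∀ i j, 0 < A i j) {w : Fin n → ℝ} (hw : w ∈ intSimplex n) :
    ∃ c, ∀ x j, c + (x j - w ⬝ᵥ x) ≤ freeEnergy A w x := by
  have := nonempty_of_mem_intSimplex hw
  obtain ⟨ij, hmin⟩ := Finite.exists_min fun ij : Fin n × Fin n => Real.log (A ij.1 ij.2)
  refine ⟨Real.log (A ij.1 ij.2), fun x j => ?_⟩
  rw [← add_sub_assoc, freeEnergy]
  refine sub_le_sub_right ?_ _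
  calc Real.log (A ij.1 ij.2) + x j
      = ∑ i, w i * (Real.log (A ij.1 ij.2) + x j) := by rw [← Finset.sum_mul, hw.2, one_mul]
    _ ≤ ∑ i, w i * Real.log ((A *ᵥ (Real.exp ∘ x)) i) :=
        Finset.sum_le_sum fun i _ => mul_le_mul_of_nonneg_left
          ((add_le_add_left (hmin (i, j)) _).trans
            (log_add_le_log_mulVec_exp (fun i j => (hpos i j).le) (hpos i j) x)) (hw.1 i).le

theorem mul_exp_neg_le_expAppraisal_of_sub_dotProduct_le {n : ℕ} {A : Matrix (Fin n) (Fin n) ℝ}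
    (hA : A ∈ Matrix.rowStochastic ℝ (Fin n)) {w : Fin n → ℝ} (hw : w ∈ intSimplex n)
    {x : Fin n → ℝ} {M : ℝ} (hM : ∀ k, x k - w ⬝ᵥ x ≤ M) (i j : Fin n) :
    A i j * Real.exp (-(M / w j)) ≤ expAppraisal A x i j := by
  have hzero : w ⬝ᵥ (fun k => x k - w ⬝ᵥ x) = 0 := by
    simp only [dotProduct, mul_sub, Finset.sum_sub_distrib, ← Finset.sum_mul, hw.2, one_mul,
      sub_self]
  have hlow := sub_div_le_of_le_dotProduct hw.1 hw.2 hM hzero.ge j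
  rw [sub_zero] at hlow
  exact mul_exp_neg_le_expAppraisal hA (fun k => by linarith [hM k]) i

theorem donorFlow_sub {n : ℕ} (A : Matrix (Fin n) (Fin n) ℝ) (v w : Fin n → ℝ) :
    donorFlow A (v - w) = donorFlow A v - donorFlow A w := by
  simp only [donorFlow_eq_vecMul_sub, Matrix.sub_vecMul]
  abel

theorem donorFlow_fin_two {S : Matrix (Fin 2) (Fin 2) ℝ}
    (hS : S ∈ Matrix.rowStochastic ℝ (Fin 2)) {v : Fin 2 → ℝ} (hv : ∑ i, v i = 0) :
    donorFlow S v = -(S 0 1 + S 1 0) • v := by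
  have hrow := Matrix.sum_row_of_mem_rowStochastic hS
  simp only [Fin.sum_univ_two] at hv hrow
  ext i
  rw [donorFlow, Fin.sum_univ_two, Pi.smul_apply, smul_eq_mul]
  fin_cases i <;> simp only [Fin.zero_eta, Fin.mk_one]
  · linear_combination v 0 * hrow 0 + S 1 0 * hv
  · linear_combination v 1 * hrow 1 + S 0 1 * hv

theorem IsCumulativeTrajectory.hasDerivWithinAt_freeEnergy_sub {n : ℕ} {p : Fin n → ℝ → ℝ}
    {A₀ : Matrix (Fin n) (Fin n) ℝ} {w₀ : Fin n → ℝ} {y w : ℝ → Fin n → ℝ} {z Θ : ℝ → ℝ}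
    (hA : A₀ ∈ Matrix.rowStochastic ℝ (Fin n)) (h : IsCumulativeTrajectory p A₀ w₀ y w)
    (hz : ∀ t ∈ Set.Ici 0, HasDerivWithinAt z (w t ⬝ᵥ perf p (w t)) (Set.Ici 0) t)
    (hΘ : ∀ t ∈ Set.Ici 0, HasDerivWithinAt Θ
      (w t ⬝ᵥ expAppraisal A₀ (y t) *ᵥ perf p (w t)) (Set.Ici 0) t)
    (v : Fin n → ℝ) {t : ℝ} (ht : t ∈ Set.Ici 0) :
    HasDerivWithinAt (fun t => freeEnergy A₀ v (y t) - (Θ t - z t))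
      (donorFlow (expAppraisal A₀ (y t)) (v - w t) ⬝ᵥ perf p (w t)) (Set.Ici 0) t := by
  rw [donorFlow_sub, sub_dotProduct, donorFlow_dotProduct _ (w t)]
  exact (hasDerivWithinAt_freeEnergy hA v (h.deriv_y t ht)).fun_sub ((hΘ t ht).fun_sub (hz t ht))

section FinTwo

variable {p : Fin 2 → ℝ → ℝ} {A₀ : Matrix (Fin 2) (Fin 2) ℝ} {w₀ : Fin 2 → ℝ}
  {y w : ℝ → Fin 2 → ℝ} {pstar : ℝ} {wopt : Fin 2 → ℝ} {z Θ : ℝ → ℝ}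

namespace IsCumulativeTrajectory

theorem antitoneOn_freeEnergy_add (hanti : ∀ i, StrictAntiOn (p i) (Set.Ioc 0 1))
    (hA : A₀ ∈ Matrix.rowStochastic ℝ (Fin 2)) (hq : IsOptimalPair p (pstar, wopt))
    (h : IsCumulativeTrajectory p A₀ w₀ y w)
    (hz : ∀ t ∈ Set.Ici 0, HasDerivWithinAt z (w t ⬝ᵥ perf p (w t)) (Set.Ici 0) t)
    (hΘ : ∀ t ∈ Set.Ici 0, HasDerivWithinAt Θ
      (w t ⬝ᵥ expAppraisal A₀ (y t) *ᵥ perf p (w t)) (Set.Ici 0) t)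
    {κ : ℝ} (hκ : ∀ t ∈ Set.Ici 0, κ ≤ expAppraisal A₀ (y t) 0 1 + expAppraisal A₀ (y t) 1 0) :
    AntitoneOn (fun t => freeEnergy A₀ wopt (y t) - (Θ t - z t) + κ * (wopt ⬝ᵥ y t - z t))
      (Set.Ici 0) := by
  have hnonneg : ∀ t ∈ Set.Ici 0, 0 ≤ -(donorFlow (expAppraisal A₀ (y t)) (wopt - w t) ⬝ᵥ
      perf p (w t) + κ * ((wopt - w t) ⬝ᵥ perf p (w t))) := fun t ht => by
    have hsum : ∑ i, (wopt - w t) i = 0 := by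
      simp only [Pi.sub_apply, Finset.sum_sub_distrib, hq.2.1.2, (h.mem_w t ht).2, sub_self]
    rw [donorFlow_fin_two (expAppraisal_mem_rowStochastic hA _) hsum, smul_dotProduct,
      smul_eq_mul, ← add_mul, ← neg_mul]
    exact mul_nonneg (by linarith [hκ t ht]) (hq.sub_dotProduct_perf_nonneg hanti (h.mem_w t ht))
  simpa only [neg_neg] using (monotoneOn_of_forall_hasDerivWithinAt_nonneg (convex_Ici 0)
    (fun t ht => ((h.hasDerivWithinAt_freeEnergy_sub hA hz hΘ wopt ht).fun_add
      ((h.hasDerivWithinAt_dotProduct_sub hz wopt ht).const_mul κ)).fun_neg) hnonneg).neg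

theorem exists_forall_sub_dotProduct_le (hcont : ∀ i, ContinuousOn (p i) (Set.Ioc 0 1))
    (hanti : ∀ i, StrictAntiOn (p i) (Set.Ioc 0 1))
    (hint : ∀ i, MeasureTheory.IntegrableOn (p i) (Set.Ioc 0 1))
    (hA : A₀ ∈ Matrix.rowStochastic ℝ (Fin 2)) (hpos : ∀ i j, 0 < A₀ i j)
    (hq : IsOptimalPair p (pstar, wopt)) (h : IsCumulativeTrajectory p A₀ w₀ y w) :
    ∃ M, ∀ t ∈ Set.Ici 0, ∀ j, y t j - wopt ⬝ᵥ y t ≤ M := by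
  obtain ⟨z, -, hz⟩ := h.exists_hasDerivWithinAt_dotProduct_perf hcont
  obtain ⟨Θ, -, hΘ⟩ := h.exists_hasDerivWithinAt_dotProduct_mulVec_perf hcont hA
  obtain ⟨B, hB⟩ := h.exists_forall_abs_sub_le hcont hint hz hΘ
  obtain ⟨c, hc⟩ := exists_forall_add_le_freeEnergy hpos hq.2.1
  have hmono := h.antitoneOn_freeEnergy_add hanti hA hq hz hΘ (κ := 0) fun t _ =>
    have hS := (expAppraisal_mem_rowStochastic hA (y t)).1
    add_nonneg (hS 0 1) (hS 1 0)
  refine ⟨freeEnergy A₀ wopt (y 0) - (Θ 0 - z 0) + B - c, fun t ht j => ?_⟩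
  have hle := hmono Set.self_mem_Ici ht ht
  simp only [zero_mul, add_zero] at hle
  linarith [hc (y t) j, (abs_le.1 (hB t ht)).2]

theorem exists_forall_dotProduct_sub_le (hcont : ∀ i, ContinuousOn (p i) (Set.Ioc 0 1))
    (hanti : ∀ i, StrictAntiOn (p i) (Set.Ioc 0 1))
    (hint : ∀ i, MeasureTheory.IntegrableOn (p i) (Set.Ioc 0 1))
    (hA : A₀ ∈ Matrix.rowStochastic ℝ (Fin 2)) (hpos : ∀ i j, 0 < A₀ i j)
    (hq : IsOptimalPair p (pstar, wopt)) (h : IsCumulativeTrajectory p A₀ w₀ y w)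
    (hz : ∀ t ∈ Set.Ici 0, HasDerivWithinAt z (w t ⬝ᵥ perf p (w t)) (Set.Ici 0) t) :
    ∃ C, ∀ t ∈ Set.Ici 0, wopt ⬝ᵥ y t - z t ≤ C := by
  obtain ⟨Θ, -, hΘ⟩ := h.exists_hasDerivWithinAt_dotProduct_mulVec_perf hcont hA
  obtain ⟨B, hB⟩ := h.exists_forall_abs_sub_le hcont hint hz hΘ
  obtain ⟨M, hM⟩ := h.exists_forall_sub_dotProduct_le hcont hanti hint hA hpos hq
  obtain ⟨c, hc⟩ := exists_forall_add_le_freeEnergy hpos hq.2.1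
  set κ := A₀ 0 1 * Real.exp (-(M / wopt 1))
  have hκ : 0 < κ := mul_pos (hpos 0 1) (Real.exp_pos _)
  have hmono := h.antitoneOn_freeEnergy_add hanti hA hq hz hΘ (κ := κ) fun t ht =>
    le_add_of_le_of_nonneg
      (mul_exp_neg_le_expAppraisal_of_sub_dotProduct_le hA hq.2.1 (hM t ht) 0 1)
      ((expAppraisal_mem_rowStochastic hA (y t)).1 1 0)
  refine ⟨(freeEnergy A₀ wopt (y 0) - (Θ 0 - z 0) + κ * (wopt ⬝ᵥ y 0 - z 0) + B - c) / κ,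
    fun t ht => ?_⟩
  obtain ⟨j, hj⟩ := exists_dotProduct_le_of_mem_intSimplex hq.2.1 (y t)
  rw [le_div_iff₀' hκ]
  linarith [hmono Set.self_mem_Ici ht ht, hc (y t) j, (abs_le.1 (hB t ht)).2]

theorem exists_tendsto_of_fin_two (hcont : ∀ i, ContinuousOn (p i) (Set.Ioc 0 1))
    (hanti : ∀ i, StrictAntiOn (p i) (Set.Ioc 0 1))
    (hint : ∀ i, MeasureTheory.IntegrableOn (p i) (Set.Ioc 0 1))
    (hA : A₀ ∈ Matrix.rowStochastic ℝ (Fin 2)) (hirr : A₀.IsIrreducible)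
    (hpos : ∀ i j, 0 < A₀ i j) (hq : IsOptimalPair p (pstar, wopt))
    (h : IsCumulativeTrajectory p A₀ w₀ y w) :
    ∃ x, Tendsto (fun t => (expAppraisal A₀ (y t), w t)) atTop (𝓝 (expAppraisal A₀ x, wopt)) ∧
      donorFlow (expAppraisal A₀ x) wopt = 0 := by
  obtain ⟨z, -, hz⟩ := h.exists_hasDerivWithinAt_dotProduct_perf hcont
  obtain ⟨M, hM⟩ := h.exists_forall_sub_dotProduct_le hcont hanti hint hA hpos hq
  obtain ⟨C, hC⟩ := h.exists_forall_dotProduct_sub_le hcont hanti hint hA hpos hq hz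
  exact h.exists_tendsto_of_sub_le hcont hanti hA hirr (fun i => hpos i i) hq hz (C := M + C)
    fun t ht j => by linarith [hM t ht j, hC t ht]

end IsCumulativeTrajectory

end FinTwo

/-! ### Convergence of the appraisals and workloads -/

section ASAP

variable {n : ℕ} {p : Fin n → ℝ → ℝ} {A₀ : Matrix (Fin n) (Fin n) ℝ} {w₀ : Fin n → ℝ}
  {A : ℝ → Matrix (Fin n) (Fin n) ℝ} {w : ℝ → Fin n → ℝ} {pstar : ℝ} {wopt : Fin n → ℝ}

theorem isLeftDominantEigenvector_expAppraisal (hA : A₀ ∈ Matrix.rowStochastic ℝ (Fin n))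
    (hirr : A₀.IsIrreducible) (hw : wopt ∈ intSimplex n) {x : Fin n → ℝ}
    (h : donorFlow (expAppraisal A₀ x) wopt = 0) :
    IsLeftDominantEigenvector (expAppraisal A₀ x) wopt := by
  have hS := expAppraisal_mem_rowStochastic hA x
  exact isLeftDominantEigenvector_of_donorFlow_eq_zero
    (isIrreducible_of_samePattern hirr (samePattern_expAppraisal hA x) hS.1) hS hw h

theorem IsASAPTrajectory.exists_tendsto_of_fin_two {p : Fin 2 → ℝ → ℝ}
    {A₀ : Matrix (Fin 2) (Fin 2) ℝ} {w₀ : Fin 2 → ℝ} {A : ℝ → Matrix (Fin 2) (Fin 2) ℝ}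
    {w : ℝ → Fin 2 → ℝ} {wopt : Fin 2 → ℝ} (hcont : ∀ i, ContinuousOn (p i) (Set.Ioc 0 1))
    (hanti : ∀ i, StrictAntiOn (p i) (Set.Ioc 0 1))
    (hint : ∀ i, MeasureTheory.IntegrableOn (p i) (Set.Ioc 0 1))
    (hA : A₀ ∈ Matrix.rowStochastic ℝ (Fin 2)) (hirr : A₀.IsIrreducible)
    (hpos : ∀ i j, 0 < A₀ i j) (hw₀ : w₀ ∈ intSimplex 2) (hq : IsOptimalPair p (pstar, wopt))
    (h : IsASAPTrajectory p A₀ w₀ A w) :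
    ∃ Astar, Tendsto (fun t => (A t, w t)) atTop (𝓝 (Astar, wopt)) ∧
      (∀ i j, 0 < Astar i j) ∧ Astar ∈ Matrix.rowStochastic ℝ (Fin 2) ∧
      IsLeftDominantEigenvector Astar wopt := by
  obtain ⟨y, hy, hAy⟩ := h.exists_isCumulativeTrajectory hcont hA hw₀
  obtain ⟨x, hlim, hstat⟩ := hy.exists_tendsto_of_fin_two hcont hanti hint hA hirr hpos hq
  refine ⟨_, hlim.congr' ?_, fun i j => (samePattern_expAppraisal hA x i j).2.2 (hpos i j),
    expAppraisal_mem_rowStochastic hA x,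
    isLeftDominantEigenvector_expAppraisal hA hirr hq.2.1 hstat⟩
  filter_upwards [eventually_ge_atTop 0] with t ht
  rw [hAy t ht]

theorem IsASAPTrajectory.tendsto_of_rank_one (hcont : ∀ i, ContinuousOn (p i) (Set.Ioc 0 1))
    (hanti : ∀ i, StrictAntiOn (p i) (Set.Ioc 0 1))
    (hint : ∀ i, MeasureTheory.IntegrableOn (p i) (Set.Ioc 0 1))
    {a : Fin n → ℝ} (ha : a ∈ intSimplex n)
    (hA : Matrix.vecMulVec (fun _ => 1) a ∈ Matrix.rowStochastic ℝ (Fin n))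
    (hirr : (Matrix.vecMulVec (fun _ => 1) a).IsIrreducible) (hw₀ : w₀ ∈ intSimplex n)
    (hq : IsOptimalPair p (pstar, wopt))
    (h : IsASAPTrajectory p (Matrix.vecMulVec (fun _ => 1) a) w₀ A w) :
    Tendsto (fun t => (A t, w t)) atTop (𝓝 (Matrix.vecMulVec (fun _ => 1) wopt, wopt)) := by
  obtain ⟨y, hy, hAy⟩ := h.exists_isCumulativeTrajectory hcont hA hw₀
  refine (hy.tendsto_of_rank_one hcont hanti hint ha hA hirr hq).congr' ?_
  filter_upwards [eventually_ge_atTop 0] with t ht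
  rw [hAy t ht]

theorem IsASAPTrajectory.exists_tendsto_of_reduced_le
    (hlip : ∀ i, LocallyLipschitzOn (Set.Ioc 0 1) (p i))
    (hanti : ∀ i, StrictAntiOn (p i) (Set.Ioc 0 1))
    (hint : ∀ i, MeasureTheory.IntegrableOn (p i) (Set.Ioc 0 1))
    (hA : A₀ ∈ Matrix.rowStochastic ℝ (Fin n)) (hirr : A₀.IsIrreducible)
    (hdiag : ∀ i, 0 < A₀ i i) (hw₀ : w₀ ∈ intSimplex n) (hq : IsOptimalPair p (pstar, wopt))
    (h : IsASAPTrajectory p A₀ w₀ A w) {v u : ℝ → Fin n → ℝ}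
    (hred : IsReducedTrajectory p A₀ w₀ v u) {C : ℝ} (hC : ∀ t, 0 ≤ t → ∀ i, v t i ≤ C) :
    ∃ Astar, Tendsto (fun t => (A t, w t)) atTop (𝓝 (Astar, wopt)) ∧
      Astar ∈ Matrix.rowStochastic ℝ (Fin n) ∧ SamePattern Astar A₀ ∧
      IsLeftDominantEigenvector Astar wopt := by
  have hcont := fun i => (hlip i).continuousOn
  obtain ⟨y, hy, hAy⟩ := h.exists_isCumulativeTrajectory hcont hA hw₀
  obtain ⟨y', Θ, hy', hΘ, hv⟩ := hred.exists_isCumulativeTrajectory hcont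
  obtain ⟨x, hlim, hstat⟩ := hy'.exists_tendsto_of_sub_mean_le hcont hanti hint hA hirr hdiag hq
    hΘ (C := C) fun t ht i => by
      linarith [hv t ht i ▸ hC t ht i, Real.add_one_le_exp (y' t i - Θ t)]
  refine ⟨_, hlim.congr' ?_, expAppraisal_mem_rowStochastic hA x, samePattern_expAppraisal hA x,
    isLeftDominantEigenvector_expAppraisal hA hirr hq.2.1 hstat⟩
  filter_upwards [eventually_ge_atTop 0] with t ht
  obtain ⟨hyy', huw⟩ := Prod.mk.inj (hy'.eqOn hlip hA hy ht)
  rw [hAy t ht, hyy', huw]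

end ASAP

theorem mainTheorem1_general (n : ℕ) (hn : 1 ≤ n) (p : Fin n → ℝ → ℝ)
    (hlip : ∀ i, LocallyLipschitzOn (Set.Ioc 0 1) (p i))
    (hanti : ∀ i, StrictAntiOn (p i) (Set.Ioc 0 1))
    (hint : ∀ i, MeasureTheory.IntegrableOn (p i) (Set.Ioc 0 1))
    (hlim : ∀ i, Tendsto (p i) (𝓝[>] 0) atTop)
    (hpos : ∀ w ∈ intSimplex n, ∀ i, 0 < p i (w i)) :
    ∃ (pstar : ℝ) (wopt : Fin n → ℝ),
      IsOptimalPair p (pstar, wopt) ∧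
      (∀ q, IsOptimalPair p q → q = (pstar, wopt)) ∧
      ∀ (A₀ : Matrix (Fin n) (Fin n) ℝ) (w₀ : Fin n → ℝ),
        A₀ ∈ Matrix.rowStochastic ℝ (Fin n) → A₀.IsIrreducible → (∀ i, 0 < A₀ i i) →
        w₀ ∈ intSimplex n →
        (∃ A w, IsASAPTrajectory p A₀ w₀ A w) ∧
        (∃ v u, IsReducedTrajectory p A₀ w₀ v u) ∧
        ∀ A w, IsASAPTrajectory p A₀ w₀ A w →
          (n = 2 → (∀ i j, 0 < A₀ i j) →
            ∃ Astar : Matrix (Fin n) (Fin n) ℝ,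
              Tendsto (fun t => (A t, w t)) atTop (𝓝 (Astar, wopt)) ∧
              (∀ i j, 0 < Astar i j) ∧
              Astar ∈ Matrix.rowStochastic ℝ (Fin n) ∧
              IsLeftDominantEigenvector Astar wopt) ∧
          ((∃ a ∈ intSimplex n, A₀ = Matrix.vecMulVec (fun _ => 1) a) →
            Tendsto (fun t => (A t, w t)) atTop
              (𝓝 (Matrix.vecMulVec (fun _ => 1) wopt, wopt))) ∧
          (∀ v u, IsReducedTrajectory p A₀ w₀ v u →
            (∃ C : ℝ, ∀ t, 0 ≤ t → ∀ i, v t i ≤ C) →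
            ∃ Astar : Matrix (Fin n) (Fin n) ℝ,
              Tendsto (fun t => (A t, w t)) atTop (𝓝 (Astar, wopt)) ∧
              Astar ∈ Matrix.rowStochastic ℝ (Fin n) ∧
              SamePattern Astar A₀ ∧
              IsLeftDominantEigenvector Astar wopt) := by
  have : Nonempty (Fin n) := ⟨⟨0, hn⟩⟩
  have hcont := fun i => (hlip i).continuousOn
  obtain ⟨⟨pstar, wopt⟩, hq, huniq⟩ := existsUnique_isOptimalPair hcont hanti hlim hpos
  refine ⟨pstar, wopt, hq, huniq, fun A₀ w₀ hA hirr hdiag hw₀ => ?_⟩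
  obtain ⟨y, u, h⟩ := exists_isCumulativeTrajectory hlip hA hw₀
  obtain ⟨Θ, hΘ₀, hΘ⟩ := h.exists_hasDerivWithinAt_dotProduct_mulVec_perf hcont hA
  refine ⟨⟨_, _, h.isASAPTrajectory hA⟩, ⟨_, _, h.isReducedTrajectory hΘ₀ hΘ⟩, fun A w hASAP =>
    ⟨?_, ?_, ?_⟩⟩
  · rintro rfl hA₀
    exact hASAP.exists_tendsto_of_fin_two hcont hanti hint hA hirr hA₀ hw₀ hq
  · rintro ⟨a, ha, rfl⟩
    exact hASAP.tendsto_of_rank_one hcont hanti hint ha hA hirr hw₀ hq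
  · rintro v u hred ⟨C, hC⟩
    exact hASAP.exists_tendsto_of_reduced_le hlip hanti hint hA hirr hdiag hw₀ hq hred hC

theorem mainTheorem1 (n : ℕ) (hn : 1 ≤ n) (p : Fin n → ℝ → ℝ) (hp : IsPerformanceFamily p) :
    ∃ (pstar : ℝ) (wopt : Fin n → ℝ),
      IsOptimalPair p (pstar, wopt) ∧
      (∀ q, IsOptimalPair p q → q = (pstar, wopt)) ∧
      ∀ (A₀ : Matrix (Fin n) (Fin n) ℝ) (w₀ : Fin n → ℝ),
        A₀ ∈ Matrix.rowStochastic ℝ (Fin n) → A₀.IsIrreducible → (∀ i, 0 < A₀ i i) →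
        w₀ ∈ intSimplex n →
        (∃ A w, IsASAPTrajectory p A₀ w₀ A w) ∧
        (∃ v u, IsReducedTrajectory p A₀ w₀ v u) ∧
        ∀ A w, IsASAPTrajectory p A₀ w₀ A w →
          -- two individuals, positive initial appraisals
          (n = 2 → (∀ i j, 0 < A₀ i j) →
            ∃ Astar : Matrix (Fin n) (Fin n) ℝ,
              Tendsto (fun t => (A t, w t)) atTop (𝓝 (Astar, wopt)) ∧
              (∀ i j, 0 < Astar i j) ∧
              Astar ∈ Matrix.rowStochastic ℝ (Fin n) ∧
              IsLeftDominantEigenvector Astar wopt) ∧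
          -- rank-one initial appraisals
          ((∃ a ∈ intSimplex n, A₀ = Matrix.vecMulVec (fun _ => 1) a) →
            Tendsto (fun t => (A t, w t)) atTop
              (𝓝 (Matrix.vecMulVec (fun _ => 1) wopt, wopt))) ∧
          -- bounded reduced-order variable
          (∀ v u, IsReducedTrajectory p A₀ w₀ v u →
            (∃ C : ℝ, ∀ t, 0 ≤ t → ∀ i, v t i ≤ C) →
            ∃ Astar : Matrix (Fin n) (Fin n) ℝ,
              Tendsto (fun t => (A t, w t)) atTop (𝓝 (Astar, wopt)) ∧
              Astar ∈ Matrix.rowStochastic ℝ (Fin n) ∧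
              SamePattern Astar A₀ ∧
              IsLeftDominantEigenvector Astar wopt) :=
  mainTheorem1_general n hn p
    (fun i => (hp.each i).contDiffOn.locallyLipschitzOn (convex_Ioc 0 1))
    (fun i => (hp.each i).strictAntiOn) (fun i => (hp.each i).integrableOn)
    (fun i => (hp.each i).tendsto_zero) hp.pos
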